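/- Theorem. For $B\in\mathbb{C}^{n\times d}$ write $B_i$ for its $i$-th row, $B^\top$ for the transpose and $B^*$ for the conjugate transpose, and let $\ell_i=B_i(B^*B)^\dagger B_i^*$ be the leverage score of the $i$-th row (equivalently, $\ell_i=\|U_i\|^2$ where $U$ has orthonormal columns spanning the column space of $B$). For every constant $K$ there is a constant $c>0$, depending only on $K$, such that the following holds. Let $n,d\in\mathbb{N}$ and let $B\in\mathbb{C}^{n\times d}$ be such that $B^\top B$ is real. Let $\tilde\ell_i\ge \ell_i$ ($i\in[n]$) be overestimates of the leverage scores with $0<\sum_j\tilde\ell_j\le Kd$ (for $B\neq 0$ this holds in particular if $\tilde\ell_i\le K\ell_i$ for all $i$), and put $p_i=\tilde\ell_i/\sum_j\tilde\ell_j$. Let $0<\varepsilon\le 1$, $0<\delta<1$, $d/\delta\ge 2$, and let $t$ be an integer with $t\ge c\,d\,\varepsilon^{-2}\log(d/\delta)$. Draw indices $s_1,\dots,s_t$ independently, with $\Pr(s_j=i)=p_i$, and let $C\in\mathbb{C}^{t\times d}$ be the matrix whose $j$-th row is $B_{s_j}/\sqrt{t\,p_{s_j}}$. Then, with probability at least $1-\delta$,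 both of the following hold: (i) for all $x\in\mathbb{R}^d$, $\;|x^\top C^\top C x-x^\top B^\top Bx|\le \varepsilon\, x^\top B^*Bx$; (ii) if every row of $B$ is real or purely imaginary (that is, $B=D^{1/2}A$ with $A$ real and $D$ real diagonal, not necessarily nonnegative), then in the Löwner order $$B^\top B-\varepsilon B^*B\;\preceq\; C^\top C\;\preceq\; B^\top B+\varepsilon B^*B .$$ -/

import Mathlib

open scoped Matrix ComplexOrder

/-- The Moore–Penrose inverse of a Hermitian matrix: in an orthonormal eigenbasis every
eigenvalue `μ` is replaced by `μ⁻¹`, with `0⁻¹ = 0`. -/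
noncomputable def hermitianPinv {d : ℕ} {G : Matrix (Fin d) (Fin d) ℂ} (hG : G.IsHermitian) :
    Matrix (Fin d) (Fin d) ℂ :=
  hG.cfc (fun μ : ℝ => μ⁻¹)

/-- The Penrose equations for `hermitianPinv`. -/
theorem hermitianPinv_penrose {d : ℕ} {G : Matrix (Fin d) (Fin d) ℂ} (hG : G.IsHermitian) :
    G * hermitianPinv hG * G = G ∧
    hermitianPinv hG * G * hermitianPinv hG = hermitianPinv hG ∧
    (G * hermitianPinv hG)ᴴ = G * hermitianPinv hG ∧
    (hermitianPinv hG * G)ᴴ = hermitianPinv hG * G := by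
  have hid : cfc (fun μ : ℝ => μ) G = G := cfc_id' ℝ G hG.isSelfAdjoint
  have hP : hermitianPinv hG = cfc (fun μ : ℝ => μ⁻¹) G := (hG.cfc_eq _).symm
  have hfin : (spectrum ℝ G).Finite := Matrix.finite_real_spectrum
  have hc : ∀ f : ℝ → ℝ, ContinuousOn f (spectrum ℝ G) := fun f => hfin.continuousOn f
  have h1 : G * hermitianPinv hG = cfc (fun μ : ℝ => μ * μ⁻¹) G := by
    rw [cfc_mul (fun μ : ℝ => μ) (fun μ : ℝ => μ⁻¹) G (hc _) (hc _), hid, hP]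
  have h2 : hermitianPinv hG * G = cfc (fun μ : ℝ => μ⁻¹ * μ) G := by
    rw [cfc_mul (fun μ : ℝ => μ⁻¹) (fun μ : ℝ => μ) G (hc _) (hc _), hid, hP]
  refine ⟨?_, ?_, ?_, ?_⟩
  · calc G * hermitianPinv hG * G
        = cfc (fun μ : ℝ => μ * μ⁻¹) G * cfc (fun μ : ℝ => μ) G := by rw [h1, hid]
      _ = cfc (fun μ : ℝ => μ * μ⁻¹ * μ) G := (cfc_mul _ _ G (hc _) (hc _)).symm
      _ = G := by simp only [mul_inv_mul_cancel]; exact hid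
  · rw [h2, hP, ← cfc_mul _ _ G (hc _) (hc _)]
    congr 1
    funext μ
    simpa using mul_inv_mul_cancel μ⁻¹
  · rw [h1]
    exact (cfc_predicate (fun μ : ℝ => μ * μ⁻¹) G : IsSelfAdjoint _)
  · rw [h2]
    exact (cfc_predicate (fun μ : ℝ => μ⁻¹ * μ) G : IsSelfAdjoint _)

/-- The leverage score `ℓᵢ = Bᵢ (B* B)† Bᵢ*` of the `i`-th row `Bᵢ` of `B` (a real number). -/
noncomputable def leverageScore {n d : ℕ} (B : Matrix (Fin n) (Fin d) ℂ) (i : Fin n) : ℝ :=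
  ((B * hermitianPinv (Matrix.isHermitian_conjTranspose_mul_self B) * Bᴴ) i i).re

/-- The leverage score is the squared norm `‖Uᵢ‖²` of the `i`-th row of any matrix `U` with
orthonormal columns and the same column span as `B`, such as the left factor of a thin SVD. -/
theorem leverageScore_eq_row_norm_sq {n d r : ℕ} (B : Matrix (Fin n) (Fin d) ℂ)
    (U : Matrix (Fin n) (Fin r) ℂ) (R : Matrix (Fin r) (Fin d) ℂ) (S : Matrix (Fin d) (Fin r) ℂ)
    (hU : Uᴴ * U = 1) (hB : B = U * R) (hS : U = B * S) (i : Fin n) :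
    leverageScore B i = ∑ k, ‖U i k‖ ^ 2 := by
  have hRS : R * S = 1 := by
    calc R * S = Uᴴ * U * R * S := by rw [hU, Matrix.one_mul]
      _ = Uᴴ * (U * R * S) := by simp only [Matrix.mul_assoc]
      _ = 1 := by rw [← hB, ← hS, hU]
  have hSR : Sᴴ * Rᴴ = 1 := by
    rw [← Matrix.conjTranspose_mul, hRS, Matrix.conjTranspose_one]
  have hG : Bᴴ * B = Rᴴ * R := by
    calc Bᴴ * B = Rᴴ * (Uᴴ * U) * R := by
          rw [hB, Matrix.conjTranspose_mul]; simp only [Matrix.mul_assoc]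
      _ = Rᴴ * R := by rw [hU, Matrix.mul_one]
  have hpen := (hermitianPinv_penrose (Matrix.isHermitian_conjTranspose_mul_self B)).1
  unfold leverageScore
  set P := hermitianPinv (Matrix.isHermitian_conjTranspose_mul_self B) with hP
  rw [hG] at hpen
  have hone : R * P * Rᴴ = 1 := by
    calc R * P * Rᴴ = (Sᴴ * Rᴴ) * (R * P * Rᴴ) * (R * S) := by
          rw [hSR, hRS, Matrix.one_mul, Matrix.mul_one]
      _ = Sᴴ * (Rᴴ * R * P * (Rᴴ * R)) * S := by simp only [Matrix.mul_assoc]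
      _ = (Sᴴ * Rᴴ) * (R * S) := by rw [hpen]; simp only [Matrix.mul_assoc]
      _ = 1 := by rw [hSR, hRS, Matrix.one_mul]
  have hUU : B * P * Bᴴ = U * Uᴴ := by
    calc B * P * Bᴴ = U * R * P * (U * R)ᴴ := by rw [← hB]
      _ = U * (R * P * Rᴴ) * Uᴴ := by
          rw [Matrix.conjTranspose_mul]; simp only [Matrix.mul_assoc]
      _ = U * Uᴴ := by rw [hone, Matrix.mul_one]
  rw [hUU, Matrix.mul_apply, Complex.re_sum]
  refine Finset.sum_congr rfl fun k _ => ?_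
  rw [Matrix.conjTranspose_apply, Complex.star_def, Complex.mul_conj, Complex.ofReal_re,
    Complex.normSq_eq_norm_sq]

/-- The sampling probabilities `pᵢ = wᵢ / ∑ⱼ wⱼ`. -/
noncomputable def samplingProb {n : ℕ} (w : Fin n → ℝ) (i : Fin n) : ℝ :=
  w i / ∑ j, w j

/-- The `t × d` matrix whose `j`-th row is row `s j` of `B`, rescaled by `1 / √(t p_{s j})`. -/
noncomputable def sampledMatrix {n d t : ℕ} (B : Matrix (Fin n) (Fin d) ℂ) (p : Fin n → ℝ)
    (s : Fin t → Fin n) : Matrix (Fin t) (Fin d) ℂ :=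
  Matrix.of fun j k => ((1 / √((t : ℝ) * p (s j)) : ℝ) : ℂ) * B (s j) k

/-- All entries of the complex matrix are real. -/
def HasRealEntries {m n : ℕ} (M : Matrix (Fin m) (Fin n) ℂ) : Prop :=
  ∀ i j, (M i j).im = 0

/-- Each row is real or purely imaginary; equivalently the matrix is `D^{1/2} A` with `A` real
and `D` real diagonal, possibly with negative entries. -/
def HasRealOrImaginaryRows {m n : ℕ} (M : Matrix (Fin m) (Fin n) ℂ) : Prop :=
  ∀ i, (∀ j, (M i j).im = 0) ∨ (∀ j, (M i j).re = 0)

/-- The Löwner order `M ⪯ N` : the matrix `N - M` is positive semidefinite. -/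
def LoewnerLE {d : ℕ} (M N : Matrix (Fin d) (Fin d) ℂ) : Prop :=
  (N - M).PosSemidef

/-- The quadratic form `xᵀ M x` of a complex matrix at a real vector `x`. -/
def realQuadForm {d : ℕ} (M : Matrix (Fin d) (Fin d) ℂ) (x : Fin d → ℝ) : ℂ :=
  ∑ a, ∑ b, (x a : ℂ) * M a b * (x b : ℂ)

/-! ### Trace inequalities for pairs of symmetric matrices -/

section TraceInequality

variable {ι : Type*} [Fintype ι] [DecidableEq ι]

/-! For real x, write the entry (B x)_i as u + iv. Its square has real part u² - v² and imaginary
part 2uv = ((u+v)/√2)² - ((u-v)/√2)². Hence the error xᵀCᵀCx - xᵀBᵀBx is assembled from four sampled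
sums of squares of real linear forms, each form dominated by |(B x)_i|
(`realQuadForm_sampledMatrix_sub`). It suffices that each of the four deviates by at most (ε/4)
xᵀB*Bx outside an event of probability δ/4. When the rows are real or purely imaginary, all matrices
in the Löwner bounds are real symmetric, so real test vectors already decide them.

For one family of forms, whiten the real part of B*B. Each sampled square becomes a positive
semidefinite matrix Y of rank at most one. The leverage bound gives Y² ≼ RY with R = (∑ w)/t, and
the mean N satisfies tN ≼ 1. It remains to bound the norm of Z = ∑_j (Y_j - N), through E tr Z^{2m}.

The moments obey a recursion by exchangeable pairs. Write tr Z^{2k+2} = ∑_j tr (Y_j - N) Z^{2k+1}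
and swap Y_j with an independent copy Y', which turns Z into Z'. By symmetry the j-th expectation is
half that of tr (Z - Z')(Z^{2k+1} - Z'^{2k+1}). A trace mean value inequality and (Y - Y')² ≼ 2R(Y +
Y') bound it by (2k+1)R E tr (Y_j + N) Z^{2k}. Summing over j produces Z + 2tN, and absorbing the
odd moment gives E tr Z^{2k+2} ≤ (r² + 4r) E tr Z^{2k} for every r ≥ (2k+1)R. Iterating from tr 1 =
d and applying Markov with m of order log(d/δ) finishes. -/

theorem Matrix.exists_orthogonal_diagonalization {Z : Matrix ι ι ℝ} (hZ : Zᵀ = Z) :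
    ∃ (U : Matrix ι ι ℝ) (l : ι → ℝ),
      Uᵀ * U = 1 ∧ U * Uᵀ = 1 ∧ Z = U * Matrix.diagonal l * Uᵀ := by
  have hH : Z.IsHermitian := by
    rw [Matrix.IsHermitian, Matrix.conjTranspose_eq_transpose_of_trivial, hZ]
  refine ⟨(hH.eigenvectorUnitary : Matrix ι ι ℝ), hH.eigenvalues, ?_, ?_, ?_⟩
  · have := Unitary.coe_star_mul_self hH.eigenvectorUnitary
    rwa [Matrix.star_eq_conjTranspose, Matrix.conjTranspose_eq_transpose_of_trivial] at this
  · have := Unitary.coe_mul_star_self hH.eigenvectorUnitary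
    rwa [Unitary.coe_star, Matrix.star_eq_conjTranspose, Matrix.conjTranspose_eq_transpose_of_trivial] at this
  · have := hH.spectral_theorem
    rw [Unitary.conjStarAlgAut_apply, Matrix.star_eq_conjTranspose,
      Matrix.conjTranspose_eq_transpose_of_trivial] at this
    exact this

theorem Matrix.orthogonal_diagonal_pow {U : Matrix ι ι ℝ} (hU : Uᵀ * U = 1) (hU' : U * Uᵀ = 1)
    (l : ι → ℝ) (k : ℕ) :
    (U * Matrix.diagonal l * Uᵀ) ^ k = U * Matrix.diagonal (fun a => l a ^ k) * Uᵀ := by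
  induction k with
  | zero => simp [hU']
  | succ k ih =>
    rw [pow_succ, ih]
    calc U * Matrix.diagonal (fun a => l a ^ k) * Uᵀ * (U * Matrix.diagonal l * Uᵀ)
        = U * Matrix.diagonal (fun a => l a ^ k) * (Uᵀ * U) * Matrix.diagonal l * Uᵀ := by
          simp only [Matrix.mul_assoc]
      _ = U * (Matrix.diagonal (fun a => l a ^ k) * Matrix.diagonal l) * Uᵀ := by
          rw [hU, Matrix.mul_one, Matrix.mul_assoc U]
      _ = _ := by rw [Matrix.diagonal_mul_diagonal]; simp only [pow_succ]

theorem Matrix.transpose_mul_sub_mul_apply {U V : Matrix ι ι ℝ} (hU : Uᵀ * U = 1)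
    (hV : Vᵀ * V = 1) (l m : ι → ℝ) (a b : ι) :
    (Uᵀ * (U * Matrix.diagonal l * Uᵀ - V * Matrix.diagonal m * Vᵀ) * V) a b
      = (l a - m b) * (Uᵀ * V) a b := by
  have h : Uᵀ * (U * Matrix.diagonal l * Uᵀ - V * Matrix.diagonal m * Vᵀ) * V
      = Matrix.diagonal l * (Uᵀ * V) - (Uᵀ * V) * Matrix.diagonal m := by
    rw [Matrix.mul_sub, Matrix.sub_mul]
    congr 1
    · calc _ = (Uᵀ * U) * Matrix.diagonal l * (Uᵀ * V) := by simp only [Matrix.mul_assoc]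
        _ = _ := by rw [hU, Matrix.one_mul]
    · calc _ = Uᵀ * V * Matrix.diagonal m * (Vᵀ * V) := by simp only [Matrix.mul_assoc]
        _ = _ := by rw [hV, Matrix.mul_one]
  rw [h, Matrix.sub_apply, Matrix.diagonal_mul, Matrix.mul_diagonal]
  ring

theorem Matrix.trace_mul_transpose_mul_diagonal (E F : Matrix ι ι ℝ) (f : ι → ℝ) :
    (E * Fᵀ * Matrix.diagonal f).trace = ∑ a, ∑ b, E a b * F a b * f a := by
  simp only [Matrix.trace, Matrix.diag, Matrix.mul_diagonal]
  simp only [Matrix.mul_apply, Matrix.transpose_apply, Finset.sum_mul]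

/-- Inserting V Vᵀ = 1 expresses the trace through the overlaps of the two eigenbases. The squared
overlaps are nonnegative weights independent of k, so a trace inequality between such expressions
reduces to a scalar one for each pair of eigenvalues. -/
theorem Matrix.trace_sub_mul_pow {U V : Matrix ι ι ℝ} (hU : Uᵀ * U = 1) (hU' : U * Uᵀ = 1)
    (hV : Vᵀ * V = 1) (hV' : V * Vᵀ = 1) (l m : ι → ℝ) (k : ℕ) :
    ((U * Matrix.diagonal l * Uᵀ - V * Matrix.diagonal m * Vᵀ)
        * (U * Matrix.diagonal l * Uᵀ) ^ k).trace
      = ∑ a, ∑ b, (l a - m b) * l a ^ k * (Uᵀ * V) a b ^ 2 := by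
  set D := U * Matrix.diagonal l * Uᵀ - V * Matrix.diagonal m * Vᵀ with hD
  rw [Matrix.orthogonal_diagonal_pow hU hU']
  calc (D * (U * Matrix.diagonal (fun a => l a ^ k) * Uᵀ)).trace
      = ((D * (U * Matrix.diagonal (fun a => l a ^ k))) * Uᵀ).trace := by
        simp only [Matrix.mul_assoc]
    _ = (Uᵀ * (D * (U * Matrix.diagonal (fun a => l a ^ k)))).trace := Matrix.trace_mul_comm _ _
    _ = (Uᵀ * D * (V * Vᵀ) * U * Matrix.diagonal (fun a => l a ^ k)).trace := by
        rw [hV', Matrix.mul_one]; simp only [Matrix.mul_assoc]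
    _ = ((Uᵀ * D * V) * (Uᵀ * V)ᵀ * Matrix.diagonal (fun a => l a ^ k)).trace := by
        rw [Matrix.transpose_mul, Matrix.transpose_transpose]; simp only [Matrix.mul_assoc]
    _ = _ := by
        rw [Matrix.trace_mul_transpose_mul_diagonal]
        refine Finset.sum_congr rfl fun a _ => Finset.sum_congr rfl fun b _ => ?_
        rw [hD, Matrix.transpose_mul_sub_mul_apply hU hV]
        ring

theorem Matrix.trace_sub_mul_sub_mul_pow {U V : Matrix ι ι ℝ} (hU : Uᵀ * U = 1)
    (hU' : U * Uᵀ = 1) (hV : Vᵀ * V = 1) (hV' : V * Vᵀ = 1) (l m : ι → ℝ) (k : ℕ) :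
    ((U * Matrix.diagonal l * Uᵀ - V * Matrix.diagonal m * Vᵀ)
        * (U * Matrix.diagonal l * Uᵀ - V * Matrix.diagonal m * Vᵀ)
        * (U * Matrix.diagonal l * Uᵀ) ^ k).trace
      = ∑ a, ∑ b, (l a - m b) ^ 2 * l a ^ k * (Uᵀ * V) a b ^ 2 := by
  set D := U * Matrix.diagonal l * Uᵀ - V * Matrix.diagonal m * Vᵀ with hD
  have hDt : Dᵀ = D := by
    simp [hD, Matrix.transpose_sub, Matrix.transpose_mul, Matrix.mul_assoc]
  rw [Matrix.orthogonal_diagonal_pow hU hU']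
  calc (D * D * (U * Matrix.diagonal (fun a => l a ^ k) * Uᵀ)).trace
      = ((D * D * (U * Matrix.diagonal (fun a => l a ^ k))) * Uᵀ).trace := by
        simp only [Matrix.mul_assoc]
    _ = (Uᵀ * (D * D * (U * Matrix.diagonal (fun a => l a ^ k)))).trace :=
        Matrix.trace_mul_comm _ _
    _ = (Uᵀ * D * (V * Vᵀ) * D * U * Matrix.diagonal (fun a => l a ^ k)).trace := by
        rw [hV', Matrix.mul_one]; simp only [Matrix.mul_assoc]
    _ = ((Uᵀ * D * V) * (Uᵀ * D * V)ᵀ * Matrix.diagonal (fun a => l a ^ k)).trace := by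
        simp only [Matrix.transpose_mul, Matrix.transpose_transpose, hDt, Matrix.mul_assoc]
    _ = _ := by
        rw [Matrix.trace_mul_transpose_mul_diagonal]
        refine Finset.sum_congr rfl fun a _ => Finset.sum_congr rfl fun b _ => ?_
        rw [hD, Matrix.transpose_mul_sub_mul_apply hU hV]
        ring

/-- Rearrangement: a^q - b^q and a^r - b^r have the same sign. -/
theorem pow_mul_pow_add_le {a b : ℝ} (ha : 0 ≤ a) (hb : 0 ≤ b) (q r : ℕ) :
    a ^ q * b ^ r + a ^ r * b ^ q ≤ a ^ (q + r) + b ^ (q + r) := by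
  have h : 0 ≤ (a ^ q - b ^ q) * (a ^ r - b ^ r) := by
    rcases le_total a b with h | h
    · exact mul_nonneg_of_nonpos_of_nonpos
        (sub_nonpos.2 (pow_le_pow_left₀ ha h _)) (sub_nonpos.2 (pow_le_pow_left₀ ha h _))
    · exact mul_nonneg
        (sub_nonneg.2 (pow_le_pow_left₀ hb h _)) (sub_nonneg.2 (pow_le_pow_left₀ hb h _))
  rw [pow_add, pow_add]
  nlinarith

/-- Factor out (x - y)² and pair the i-th term of the remaining geometric sum with its reflection.
The even total degree 2k lets absolute values be removed at the end. -/
theorem sub_mul_pow_sub_pow_le (x y : ℝ) (k : ℕ) :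
    (x - y) * (x ^ (2 * k + 1) - y ^ (2 * k + 1))
      ≤ (2 * k + 1) / 2 * ((x - y) ^ 2 * (x ^ (2 * k) + y ^ (2 * k))) := by
  have hsum : ∑ i ∈ Finset.range (2 * k + 1), x ^ i * y ^ (2 * k + 1 - 1 - i)
      ≤ (2 * k + 1) / 2 * (x ^ (2 * k) + y ^ (2 * k)) := by
    have h1 : ∑ i ∈ Finset.range (2 * k + 1), x ^ i * y ^ (2 * k + 1 - 1 - i)
        ≤ ∑ i ∈ Finset.range (2 * k + 1), |x| ^ i * |y| ^ (2 * k + 1 - 1 - i) :=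
      Finset.sum_le_sum fun i _ => by
        rw [← abs_pow, ← abs_pow, ← abs_mul]; exact le_abs_self _
    have h2 := Finset.sum_range_reflect
      (fun i => |x| ^ i * |y| ^ (2 * k + 1 - 1 - i)) (2 * k + 1)
    have h3 : ∑ i ∈ Finset.range (2 * k + 1), (|x| ^ i * |y| ^ (2 * k + 1 - 1 - i)
        + |x| ^ (2 * k + 1 - 1 - i) * |y| ^ (2 * k + 1 - 1 - (2 * k + 1 - 1 - i)))
        ≤ ∑ i ∈ Finset.range (2 * k + 1), (x ^ (2 * k) + y ^ (2 * k)) := by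
      refine Finset.sum_le_sum fun i hi => ?_
      have hi' : i ≤ 2 * k := Nat.lt_succ_iff.1 (Finset.mem_range.1 hi)
      have e1 : 2 * k + 1 - 1 - i = 2 * k - i := by omega
      have e2 : 2 * k + 1 - 1 - (2 * k + 1 - 1 - i) = i := by omega
      have e3 : i + (2 * k - i) = 2 * k := by omega
      rw [e2, e1]
      have := pow_mul_pow_add_le (abs_nonneg x) (abs_nonneg y) i (2 * k - i)
      rwa [e3, (even_two_mul k).pow_abs, (even_two_mul k).pow_abs] at this
    rw [Finset.sum_add_distrib, h2, Finset.sum_const, Finset.card_range, nsmul_eq_mul] at h3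
    rw [Nat.cast_add, Nat.cast_mul, Nat.cast_one, Nat.cast_ofNat] at h3
    linarith
  rw [← geom_sum₂_mul x y (2 * k + 1)]
  calc (x - y) * ((∑ i ∈ Finset.range (2 * k + 1), x ^ i * y ^ (2 * k + 1 - 1 - i)) * (x - y))
      = (x - y) ^ 2 * ∑ i ∈ Finset.range (2 * k + 1), x ^ i * y ^ (2 * k + 1 - 1 - i) := by ring
    _ ≤ (x - y) ^ 2 * ((2 * k + 1) / 2 * (x ^ (2 * k) + y ^ (2 * k))) :=
        mul_le_mul_of_nonneg_left hsum (sq_nonneg _)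
    _ = _ := by ring

/-- A mean value inequality for the trace of odd powers of symmetric matrices. -/
theorem Matrix.trace_sub_mul_pow_sub_pow_le {Z Z' : Matrix ι ι ℝ} (hZ : Zᵀ = Z) (hZ' : Z'ᵀ = Z')
    (k : ℕ) :
    ((Z - Z') * (Z ^ (2 * k + 1) - Z' ^ (2 * k + 1))).trace
      ≤ (2 * k + 1) / 2 * (((Z - Z') * (Z - Z') * Z ^ (2 * k)).trace
        + ((Z - Z') * (Z - Z') * Z' ^ (2 * k)).trace) := by
  obtain ⟨U, l, hU, hU', rfl⟩ := Matrix.exists_orthogonal_diagonalization hZ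
  obtain ⟨V, m, hV, hV', rfl⟩ := Matrix.exists_orthogonal_diagonalization hZ'
  have hC : ∀ a b, (Vᵀ * U) b a = (Uᵀ * V) a b := fun a b => by
    rw [← Matrix.transpose_apply (Vᵀ * U), Matrix.transpose_mul, Matrix.transpose_transpose]
  have e1 := Matrix.trace_sub_mul_pow hU hU' hV hV' l m (2 * k + 1)
  have e2 := Matrix.trace_sub_mul_pow hV hV' hU hU' m l (2 * k + 1)
  have e3 := Matrix.trace_sub_mul_sub_mul_pow hU hU' hV hV' l m (2 * k)
  have e4 := Matrix.trace_sub_mul_sub_mul_pow hV hV' hU hU' m l (2 * k)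
  rw [Finset.sum_comm] at e2 e4
  simp only [hC] at e2 e4
  rw [← neg_sub (U * Matrix.diagonal l * Uᵀ), Matrix.neg_mul, Matrix.trace_neg] at e2
  rw [← neg_sub (U * Matrix.diagonal l * Uᵀ), neg_mul_neg] at e4
  rw [Matrix.mul_sub, Matrix.trace_sub, e1, e3, e4, sub_eq_add_neg, e2, ← Finset.sum_add_distrib,
    ← Finset.sum_add_distrib, Finset.mul_sum]
  refine Finset.sum_le_sum fun a _ => ?_
  rw [← Finset.sum_add_distrib, ← Finset.sum_add_distrib, Finset.mul_sum]
  refine Finset.sum_le_sum fun b _ => ?_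
  have := mul_le_mul_of_nonneg_right (sub_mul_pow_sub_pow_le (l a) (m b) k)
    (sq_nonneg ((Uᵀ * V) a b))
  linarith

end TraceInequality

/-! ### Moment recursion by exchangeable pairs -/

section Moments

set_option linter.unusedSectionVars false

variable {κ : Type*} [Fintype κ] {t : ℕ}

/-- The probability of drawing the sequence `σ` in independent draws from the distribution `p`. -/
def drawWeight (p : κ → ℝ) (σ : Fin t → κ) : ℝ := ∏ j, p (σ j)

theorem drawWeight_nonneg {p : κ → ℝ} (hp : ∀ i, 0 ≤ p i) (σ : Fin t → κ) : 0 ≤ drawWeight p σ :=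
  Finset.prod_nonneg fun j _ => hp (σ j)

theorem sum_drawWeight {p : κ → ℝ} (hp : ∑ i, p i = 1) :
    ∑ σ : Fin t → κ, drawWeight p σ = 1 := by
  have := Finset.prod_univ_sum (fun _ : Fin t => (Finset.univ : Finset κ)) (fun _ i => p i)
  rw [Fintype.piFinset_univ] at this
  simp only [drawWeight]
  rw [← this]
  simp [hp]

/-- Detailed balance for the swap, stated without division so that zero probabilities are allowed.
-/
theorem drawWeight_update_mul (p : κ → ℝ) (σ : Fin t → κ) (j : Fin t) (i : κ) :
    drawWeight p (Function.update σ j i) * p (σ j) = drawWeight p σ * p i := by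
  have h : ∀ τ : Fin t → κ, drawWeight p τ = p (τ j) * ∏ l ∈ Finset.univ.erase j, p (τ l) :=
    fun τ => (Finset.mul_prod_erase _ _ (Finset.mem_univ j)).symm
  rw [h, h σ, Function.update_self]
  have : ∏ l ∈ Finset.univ.erase j, p (Function.update σ j i l)
      = ∏ l ∈ Finset.univ.erase j, p (σ l) :=
    Finset.prod_congr rfl fun l hl => by rw [Function.update_of_ne (Finset.ne_of_mem_erase hl)]
  rw [this]
  ring

/-- Exchanging the `j`-th draw with an independent extra draw does not change expectations. -/
theorem sum_drawWeight_exchange (p : κ → ℝ) (j : Fin t) (F : (Fin t → κ) → κ → ℝ) :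
    ∑ σ : Fin t → κ, ∑ i, drawWeight p σ * p i * F σ i
      = ∑ σ : Fin t → κ, ∑ i, drawWeight p σ * p i * F (Function.update σ j i) (σ j) := by
  rw [← Fintype.sum_prod_type', ← Fintype.sum_prod_type']
  refine Finset.sum_nbij' (fun x => (Function.update x.1 j x.2, x.1 j))
    (fun x => (Function.update x.1 j x.2, x.1 j)) (by simp) (by simp) ?_ ?_ ?_
  · intro x _; simp
  · intro x _; simp
  · intro x _; simp [drawWeight_update_mul]

variable {ι : Type*} [Fintype ι] [DecidableEq ι]

theorem Matrix.PosSemidef.transpose_eq {Q : Matrix ι ι ℝ} (hQ : Q.PosSemidef) : Qᵀ = Q := by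
  rw [← Matrix.conjTranspose_eq_transpose_of_trivial]; exact hQ.1

theorem Matrix.posSemidef_mul_self {Q : Matrix ι ι ℝ} (hQ : Qᵀ = Q) : (Q * Q).PosSemidef := by
  have := Matrix.posSemidef_conjTranspose_mul_self Q
  rwa [Matrix.conjTranspose_eq_transpose_of_trivial, hQ] at this

/-- By cyclicity this is tr (S^k Q S^k). It is how Löwner inequalities are used under the trace,
against even powers. -/
theorem Matrix.trace_mul_pow_even_nonneg {Q S : Matrix ι ι ℝ} (hQ : Q.PosSemidef) (hS : Sᵀ = S)
    (k : ℕ) : 0 ≤ (Q * S ^ (2 * k)).trace := by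
  have h := (hQ.conjTranspose_mul_mul_same (S ^ k)).trace_nonneg
  rw [Matrix.conjTranspose_eq_transpose_of_trivial, Matrix.transpose_pow, hS, Matrix.mul_assoc,
    Matrix.trace_mul_comm, Matrix.mul_assoc, ← pow_add, ← two_mul] at h
  exact h

/-- Since (Y - Y')² + (Y + Y')² = 2Y² + 2Y'², one has (Y - Y')² ≼ 2Y² + 2Y'² ≼ 2R(Y + Y'). -/
theorem Matrix.trace_sub_mul_sub_mul_pow_le {Y Y' S : Matrix ι ι ℝ} {R : ℝ}
    (hY : Yᵀ = Y) (hY' : Y'ᵀ = Y') (hR : (R • Y - Y * Y).PosSemidef)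
    (hR' : (R • Y' - Y' * Y').PosSemidef) (hS : Sᵀ = S) (k : ℕ) :
    ((Y - Y') * (Y - Y') * S ^ (2 * k)).trace ≤ 2 * R * ((Y + Y') * S ^ (2 * k)).trace := by
  have hsum : ((Y + Y') * (Y + Y')).PosSemidef :=
    Matrix.posSemidef_mul_self (by rw [Matrix.transpose_add, hY, hY'])
  have h := Matrix.trace_mul_pow_even_nonneg (((hR.add hR').add (hR.add hR')).add hsum) hS k
  have e : R • Y - Y * Y + (R • Y' - Y' * Y') + (R • Y - Y * Y + (R • Y' - Y' * Y'))
      + (Y + Y') * (Y + Y') = (2 * R) • (Y + Y') - (Y - Y') * (Y - Y') := by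
    rw [two_mul, add_smul, smul_add]
    noncomm_ring
  rw [e, Matrix.sub_mul, Matrix.trace_sub, Matrix.smul_mul, Matrix.trace_smul, smul_eq_mul] at h
  linarith

/-- The centred sum of the matrices drawn by `σ`. -/
def centredSum (p : κ → ℝ) (Y : κ → Matrix ι ι ℝ) (σ : Fin t → κ) : Matrix ι ι ℝ :=
  ∑ j, (Y (σ j) - ∑ i, p i • Y i)

theorem centredSum_transpose {p : κ → ℝ} {Y : κ → Matrix ι ι ℝ} (hY : ∀ i, (Y i)ᵀ = Y i)
    (σ : Fin t → κ) : (centredSum p Y σ)ᵀ = centredSum p Y σ := by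
  simp only [centredSum, Matrix.transpose_sum, Matrix.transpose_sub, Matrix.transpose_smul, hY]

theorem centredSum_sub_update (p : κ → ℝ) (Y : κ → Matrix ι ι ℝ) (σ : Fin t → κ) (j : Fin t)
    (i : κ) : centredSum p Y σ - centredSum p Y (Function.update σ j i) = Y (σ j) - Y i := by
  unfold centredSum
  rw [← Finset.sum_sub_distrib, Finset.sum_eq_single j]
  · simp
  · intro l _ hl
    rw [Function.update_of_ne hl]; simp
  · simp

theorem sum_mul_trace_sub {p : κ → ℝ} (hp : ∑ i, p i = 1) (Y : κ → Matrix ι ι ℝ)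
    (A S : Matrix ι ι ℝ) :
    ∑ i, p i * ((A - Y i) * S).trace = ((A - ∑ i, p i • Y i) * S).trace := by
  have h : A - ∑ i, p i • Y i = ∑ i, p i • (A - Y i) := by
    simp only [smul_sub, Finset.sum_sub_distrib, ← Finset.sum_smul, hp, one_smul]
  rw [h, Matrix.sum_mul, Matrix.trace_sum]
  simp only [Matrix.smul_mul, Matrix.trace_smul, smul_eq_mul]

theorem sum_mul_trace_add {p : κ → ℝ} (hp : ∑ i, p i = 1) (Y : κ → Matrix ι ι ℝ)
    (A S : Matrix ι ι ℝ) :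
    ∑ i, p i * ((A + Y i) * S).trace = ((A + ∑ i, p i • Y i) * S).trace := by
  have h : A + ∑ i, p i • Y i = ∑ i, p i • (A + Y i) := by
    simp only [smul_add, Finset.sum_add_distrib, ← Finset.sum_smul, hp, one_smul]
  rw [h, Matrix.sum_mul, Matrix.trace_sum]
  simp only [Matrix.smul_mul, Matrix.trace_smul, smul_eq_mul]

/-- The exchange step for one draw: replace the mean by an independent copy, symmetrize under the
swap, and apply the mean value inequality. One factor Y_j - N is traded for a drop of one in the
power of Z. -/
theorem sum_drawWeight_trace_sub_mul_pow_le {p : κ → ℝ} (hp0 : ∀ i, 0 ≤ p i) (hp : ∑ i, p i = 1)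
    {Y : κ → Matrix ι ι ℝ} (hY : ∀ i, (Y i)ᵀ = Y i) {R : ℝ}
    (hR : ∀ i, (R • Y i - Y i * Y i).PosSemidef) (k : ℕ) (j : Fin t) :
    ∑ σ : Fin t → κ, drawWeight p σ *
        ((Y (σ j) - ∑ i, p i • Y i) * centredSum p Y σ ^ (2 * k + 1)).trace
      ≤ (2 * k + 1) * R * ∑ σ : Fin t → κ, drawWeight p σ *
        ((Y (σ j) + ∑ i, p i • Y i) * centredSum p Y σ ^ (2 * k)).trace := by
  set Z : (Fin t → κ) → Matrix ι ι ℝ := centredSum p Y with hZ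
  have hZt : ∀ σ, (Z σ)ᵀ = Z σ := centredSum_transpose hY
  have hL : ∑ σ : Fin t → κ, drawWeight p σ *
        ((Y (σ j) - ∑ i, p i • Y i) * Z σ ^ (2 * k + 1)).trace
      = ∑ σ : Fin t → κ, ∑ i, drawWeight p σ * p i *
        ((Y (σ j) - Y i) * Z σ ^ (2 * k + 1)).trace :=
    Finset.sum_congr rfl fun σ _ => by
      rw [← sum_mul_trace_sub hp, Finset.mul_sum]; simp only [mul_assoc]
  have hRr : ∑ σ : Fin t → κ, drawWeight p σ *
        ((Y (σ j) + ∑ i, p i • Y i) * Z σ ^ (2 * k)).trace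
      = ∑ σ : Fin t → κ, ∑ i, drawWeight p σ * p i *
        ((Y (σ j) + Y i) * Z σ ^ (2 * k)).trace :=
    Finset.sum_congr rfl fun σ _ => by
      rw [← sum_mul_trace_add hp, Finset.mul_sum]; simp only [mul_assoc]
  have hx1 := sum_drawWeight_exchange p j
    (fun σ i => ((Y (σ j) - Y i) * Z σ ^ (2 * k + 1)).trace)
  have hx2 := sum_drawWeight_exchange p j
    (fun σ i => ((Y (σ j) - Y i) * (Y (σ j) - Y i) * Z σ ^ (2 * k)).trace)
  simp only [Function.update_self] at hx1 hx2
  -- By `hx1` and `hx2` the two traces on either side have equal expectation, so each side is a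
  -- doubled version of a single sum.
  have hmv : ∑ σ : Fin t → κ, ∑ i, drawWeight p σ * p i *
        (((Y (σ j) - Y i) * Z σ ^ (2 * k + 1)).trace
          + ((Y i - Y (σ j)) * Z (Function.update σ j i) ^ (2 * k + 1)).trace)
      ≤ ∑ σ : Fin t → κ, ∑ i, drawWeight p σ * p i *
        ((2 * k + 1) / 2 * (((Y (σ j) - Y i) * (Y (σ j) - Y i) * Z σ ^ (2 * k)).trace
          + ((Y i - Y (σ j)) * (Y i - Y (σ j))
              * Z (Function.update σ j i) ^ (2 * k)).trace)) := by
    refine Finset.sum_le_sum fun σ _ => Finset.sum_le_sum fun i _ => ?_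
    refine mul_le_mul_of_nonneg_left ?_ (mul_nonneg (drawWeight_nonneg hp0 σ) (hp0 i))
    have h := Matrix.trace_sub_mul_pow_sub_pow_le (hZt σ) (hZt (Function.update σ j i)) k
    rw [hZ, centredSum_sub_update, ← hZ, Matrix.mul_sub, Matrix.trace_sub] at h
    rw [← neg_sub (Y (σ j)) (Y i), neg_mul_neg, Matrix.neg_mul, Matrix.trace_neg]
    linarith
  have hb : ∑ σ : Fin t → κ, ∑ i, drawWeight p σ * p i *
        ((Y (σ j) - Y i) * (Y (σ j) - Y i) * Z σ ^ (2 * k)).trace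
      ≤ 2 * R * ∑ σ : Fin t → κ, ∑ i, drawWeight p σ * p i *
        ((Y (σ j) + Y i) * Z σ ^ (2 * k)).trace := by
    rw [Finset.mul_sum]
    refine Finset.sum_le_sum fun σ _ => ?_
    rw [Finset.mul_sum]
    refine Finset.sum_le_sum fun i _ => ?_
    have := mul_le_mul_of_nonneg_left
      (Matrix.trace_sub_mul_sub_mul_pow_le (hY (σ j)) (hY i) (hR (σ j)) (hR i) (hZt σ) k)
      (mul_nonneg (drawWeight_nonneg hp0 σ) (hp0 i))
    linarith
  simp only [mul_left_comm _ (((2 : ℝ) * k + 1) / 2), ← Finset.mul_sum] at hmv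
  simp only [mul_add, Finset.sum_add_distrib] at hmv
  rw [← hx1, ← hx2] at hmv
  rw [hL, hRr]
  have hk : (0 : ℝ) ≤ (2 * k + 1) / 2 := by positivity
  have := mul_le_mul_of_nonneg_left hb hk
  linarith

/-- Summing the exchange step over the draws gives Z + 2tN on the right, and tN ≼ 1 leaves only an
odd moment to control. -/
theorem sum_drawWeight_trace_pow_succ_le {p : κ → ℝ} (hp0 : ∀ i, 0 ≤ p i) (hp : ∑ i, p i = 1)
    {Y : κ → Matrix ι ι ℝ} (hY : ∀ i, (Y i)ᵀ = Y i) {R : ℝ} (hR0 : 0 ≤ R)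
    (hR : ∀ i, (R • Y i - Y i * Y i).PosSemidef)
    (hN : (1 - (t : ℝ) • ∑ i, p i • Y i).PosSemidef) (k : ℕ) {r : ℝ} (hr : (2 * k + 1) * R ≤ r) :
    ∑ σ : Fin t → κ, drawWeight p σ * (centredSum p Y σ ^ (2 * (k + 1))).trace
      ≤ (r ^ 2 + 4 * r) *
        ∑ σ : Fin t → κ, drawWeight p σ * (centredSum p Y σ ^ (2 * k)).trace := by
  set Z : (Fin t → κ) → Matrix ι ι ℝ := centredSum p Y with hZ
  set N := ∑ i, p i • Y i with hNdef
  have hZt : ∀ σ, (Z σ)ᵀ = Z σ := centredSum_transpose hY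
  have hZj : ∀ σ, Z σ = ∑ j, (Y (σ j) - N) := fun σ => rfl
  set r₀ := (2 * k + 1) * R with hr₀
  have hr₀0 : 0 ≤ r₀ := by positivity
  have h1 : ∑ σ : Fin t → κ, drawWeight p σ * (Z σ ^ (2 * (k + 1))).trace
      ≤ r₀ * ∑ σ : Fin t → κ, drawWeight p σ *
        ((Z σ ^ (2 * k + 1)).trace + 2 * (Z σ ^ (2 * k)).trace) := by
    calc ∑ σ : Fin t → κ, drawWeight p σ * (Z σ ^ (2 * (k + 1))).trace
        = ∑ j, ∑ σ : Fin t → κ, drawWeight p σ * ((Y (σ j) - N) * Z σ ^ (2 * k + 1)).trace := by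
          rw [Finset.sum_comm]
          refine Finset.sum_congr rfl fun σ _ => ?_
          rw [← Finset.mul_sum, ← Matrix.trace_sum, ← Matrix.sum_mul, ← hZj, ← pow_succ']
          rfl
      _ ≤ ∑ j, r₀ * ∑ σ : Fin t → κ, drawWeight p σ * ((Y (σ j) + N) * Z σ ^ (2 * k)).trace :=
          Finset.sum_le_sum fun j _ => sum_drawWeight_trace_sub_mul_pow_le hp0 hp hY hR k j
      _ = r₀ * ∑ σ : Fin t → κ, drawWeight p σ *
            ((Z σ ^ (2 * k + 1)).trace + 2 * (((t : ℝ) • N) * Z σ ^ (2 * k)).trace) := by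
          rw [← Finset.mul_sum, Finset.sum_comm]
          congr 1
          refine Finset.sum_congr rfl fun σ _ => ?_
          rw [← Finset.mul_sum, ← Matrix.trace_sum, ← Matrix.sum_mul]
          have e : ∑ j, (Y (σ j) + N) = Z σ + (2 : ℝ) • ((t : ℝ) • N) := by
            rw [hZj, Finset.sum_add_distrib, Finset.sum_sub_distrib, Finset.sum_const,
              Finset.card_univ, Fintype.card_fin, ← Nat.cast_smul_eq_nsmul ℝ, two_smul]
            abel
          rw [e, Matrix.add_mul, Matrix.trace_add, ← pow_succ', Matrix.smul_mul (2 : ℝ),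
            Matrix.trace_smul, smul_eq_mul]
      _ ≤ _ := by
          refine mul_le_mul_of_nonneg_left (Finset.sum_le_sum fun σ _ => ?_) hr₀0
          refine mul_le_mul_of_nonneg_left ?_ (drawWeight_nonneg hp0 σ)
          have := Matrix.trace_mul_pow_even_nonneg hN (hZt σ) k
          rw [Matrix.sub_mul, Matrix.trace_sub, Matrix.one_mul] at this
          linarith
  -- From (Z - r₀)² ≽ 0 tested against Z^{2k}: the odd moment costs half of the next even moment,
  -- which is later moved to the left side.
  have h2 : r₀ * ∑ σ : Fin t → κ, drawWeight p σ *
        ((Z σ ^ (2 * k + 1)).trace + 2 * (Z σ ^ (2 * k)).trace)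
      ≤ ∑ σ : Fin t → κ, drawWeight p σ *
        (1 / 2 * (Z σ ^ (2 * (k + 1))).trace
          + (1 / 2 * r₀ ^ 2 + 2 * r₀) * (Z σ ^ (2 * k)).trace) := by
    rw [Finset.mul_sum]
    refine Finset.sum_le_sum fun σ _ => ?_
    rw [mul_left_comm]
    refine mul_le_mul_of_nonneg_left ?_ (drawWeight_nonneg hp0 σ)
    have hsq : ((Z σ - r₀ • 1) * (Z σ - r₀ • 1)).PosSemidef :=
      Matrix.posSemidef_mul_self (by simp [hZt σ])
    have := Matrix.trace_mul_pow_even_nonneg hsq (hZt σ) k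
    have e : (Z σ - r₀ • 1) * (Z σ - r₀ • 1) * Z σ ^ (2 * k)
        = Z σ ^ (2 * (k + 1)) - (2 * r₀) • Z σ ^ (2 * k + 1) + r₀ ^ 2 • Z σ ^ (2 * k) := by
      have : (Z σ - r₀ • 1) * (Z σ - r₀ • 1) = Z σ ^ 2 - (2 * r₀) • Z σ + r₀ ^ 2 • 1 := by
        rw [Matrix.sub_mul, Matrix.mul_sub, Matrix.mul_sub, Matrix.smul_mul, Matrix.smul_mul,
          Matrix.mul_smul, Matrix.one_mul, Matrix.one_mul, Matrix.mul_one, smul_smul, ← pow_two,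
          ← pow_two, two_mul, add_smul]
        abel
      rw [this, Matrix.add_mul, Matrix.sub_mul, Matrix.smul_mul, Matrix.smul_mul, Matrix.one_mul,
        ← pow_add, ← pow_succ', mul_add, mul_one, add_comm 2]
    rw [e, Matrix.trace_add, Matrix.trace_sub, Matrix.trace_smul, Matrix.trace_smul, smul_eq_mul,
      smul_eq_mul] at this
    linarith
  have hm : 0 ≤ ∑ σ : Fin t → κ, drawWeight p σ * (Z σ ^ (2 * k)).trace :=
    Finset.sum_nonneg fun σ _ => mul_nonneg (drawWeight_nonneg hp0 σ) (by
      simpa using Matrix.trace_mul_pow_even_nonneg Matrix.PosSemidef.one (hZt σ) k)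
  have h3 : ∑ σ : Fin t → κ, drawWeight p σ *
        (1 / 2 * (Z σ ^ (2 * (k + 1))).trace
          + (1 / 2 * r₀ ^ 2 + 2 * r₀) * (Z σ ^ (2 * k)).trace)
      = 1 / 2 * ∑ σ : Fin t → κ, drawWeight p σ * (Z σ ^ (2 * (k + 1))).trace
        + (1 / 2 * r₀ ^ 2 + 2 * r₀) *
          ∑ σ : Fin t → κ, drawWeight p σ * (Z σ ^ (2 * k)).trace := by
    simp only [mul_add, Finset.sum_add_distrib, Finset.mul_sum, mul_left_comm (drawWeight p _)]
  have h4 : r₀ ^ 2 + 4 * r₀ ≤ r ^ 2 + 4 * r := by nlinarith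
  have h5 := mul_le_mul_of_nonneg_right h4 hm
  linarith

theorem sum_drawWeight_trace_pow_le {p : κ → ℝ} (hp0 : ∀ i, 0 ≤ p i) (hp : ∑ i, p i = 1)
    {Y : κ → Matrix ι ι ℝ} (hY : ∀ i, (Y i)ᵀ = Y i) {R : ℝ} (hR0 : 0 ≤ R)
    (hR : ∀ i, (R • Y i - Y i * Y i).PosSemidef)
    (hN : (1 - (t : ℝ) • ∑ i, p i • Y i).PosSemidef) {m : ℕ} {r : ℝ} (hr : 2 * m * R ≤ r)
    {k : ℕ} (hk : k ≤ m) :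
    ∑ σ : Fin t → κ, drawWeight p σ * (centredSum p Y σ ^ (2 * k)).trace
      ≤ (r ^ 2 + 4 * r) ^ k * Fintype.card ι := by
  have hr0 : 0 ≤ r := le_trans (by positivity) hr
  induction k with
  | zero =>
    simp only [Nat.mul_zero, pow_zero, Matrix.trace_one, ← Finset.sum_mul, sum_drawWeight hp,
      le_refl]
  | succ k ih =>
    refine (sum_drawWeight_trace_pow_succ_le hp0 hp hY hR0 hR hN k (r := r) ?_).trans ?_
    · refine le_trans (mul_le_mul_of_nonneg_right ?_ hR0) hr
      have : ((k + 1 : ℕ) : ℝ) ≤ m := Nat.cast_le.2 hk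
      push_cast at this
      linarith
    · rw [pow_succ' (r ^ 2 + 4 * r), mul_assoc]
      exact mul_le_mul_of_nonneg_left (ih (by omega)) (by positivity)

end Moments

/-! ### Whitening and the tail bound -/

section Concentration

set_option linter.unusedSectionVars false

variable {ι : Type*} [Fintype ι] [DecidableEq ι]

theorem Matrix.dotProduct_orthogonal_diagonal_mulVec (U : Matrix ι ι ℝ) (l g : ι → ℝ) :
    g ⬝ᵥ ((U * Matrix.diagonal l * Uᵀ) *ᵥ g) = ∑ a, l a * (Uᵀ *ᵥ g) a ^ 2 := by
  rw [← Matrix.mulVec_mulVec, ← Matrix.mulVec_mulVec, Matrix.dotProduct_mulVec,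
    ← Matrix.mulVec_transpose]
  simp only [dotProduct, Matrix.mulVec_diagonal]
  exact Finset.sum_congr rfl fun a _ => by ring

/-- The quadratic form of a symmetric matrix is controlled by the trace of an even power. -/
theorem Matrix.abs_dotProduct_mulVec_le_of_trace_pow_le {Z : Matrix ι ι ℝ} (hZ : Zᵀ = Z) {m : ℕ}
    (hm : m ≠ 0) {η : ℝ} (hη : 0 ≤ η) (h : (Z ^ (2 * m)).trace ≤ η ^ (2 * m)) (g : ι → ℝ) :
    |g ⬝ᵥ (Z *ᵥ g)| ≤ η * (g ⬝ᵥ g) := by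
  obtain ⟨U, l, hU, hU', rfl⟩ := Matrix.exists_orthogonal_diagonalization hZ
  rw [Matrix.orthogonal_diagonal_pow hU hU', Matrix.trace_mul_comm, ← Matrix.mul_assoc, hU,
    Matrix.one_mul, Matrix.trace_diagonal] at h
  have hl : ∀ a, |l a| ≤ η := fun a => by
    refine le_of_pow_le_pow_left₀ (n := 2 * m) (by omega) hη ?_
    rw [(even_two_mul m).pow_abs]
    exact (Finset.single_le_sum (f := fun a => l a ^ (2 * m))
      (fun b _ => (even_two_mul m).pow_nonneg _) (Finset.mem_univ a)).trans h
  have hg : g ⬝ᵥ g = ∑ a, (Uᵀ *ᵥ g) a ^ 2 := by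
    have := Matrix.dotProduct_orthogonal_diagonal_mulVec U (fun _ => 1) g
    simpa [hU'] using this
  rw [Matrix.dotProduct_orthogonal_diagonal_mulVec, hg, Finset.mul_sum]
  refine (Finset.abs_sum_le_sum_abs _ _).trans (Finset.sum_le_sum fun a _ => ?_)
  rw [abs_mul, abs_of_nonneg (sq_nonneg ((Uᵀ *ᵥ g) a))]
  exact mul_le_mul_of_nonneg_right (hl a) (sq_nonneg _)

theorem Matrix.PosSemidef.of_dotProduct_mulVec_real {Q : Matrix ι ι ℝ} (hQ : Qᵀ = Q)
    (h : ∀ g, 0 ≤ g ⬝ᵥ (Q *ᵥ g)) : Q.PosSemidef := by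
  refine Matrix.PosSemidef.of_dotProduct_mulVec_nonneg ?_ fun g => ?_
  · rw [Matrix.IsHermitian, Matrix.conjTranspose_eq_transpose_of_trivial, hQ]
  · rw [star_trivial]; exact h g

theorem Matrix.PosSemidef.dotProduct_mulVec_real_nonneg {Q : Matrix ι ι ℝ} (hQ : Q.PosSemidef)
    (g : ι → ℝ) : 0 ≤ g ⬝ᵥ (Q *ᵥ g) := by
  have := hQ.dotProduct_mulVec_nonneg g
  rwa [star_trivial] at this

theorem Matrix.PosSemidef.exists_orthogonal_diagonalization {D : Matrix ι ι ℝ}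
    (hD : D.PosSemidef) :
    ∃ (U : Matrix ι ι ℝ) (l : ι → ℝ), (∀ a, 0 ≤ l a) ∧
      Uᵀ * U = 1 ∧ U * Uᵀ = 1 ∧ D = U * Matrix.diagonal l * Uᵀ := by
  obtain ⟨U, l, hU, hU', hDU⟩ := Matrix.exists_orthogonal_diagonalization hD.transpose_eq
  refine ⟨U, l, fun a => ?_, hU, hU', hDU⟩
  have h := hD.dotProduct_mulVec_real_nonneg (U *ᵥ Pi.single a 1)
  rw [hDU, Matrix.dotProduct_orthogonal_diagonal_mulVec, Matrix.mulVec_mulVec, hU,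
    Matrix.one_mulVec, Finset.sum_eq_single a (fun b _ hb => by simp [hb]) (by simp)] at h
  simpa using h

theorem Matrix.PosSemidef.exists_eq_transpose_mul_self {D : Matrix ι ι ℝ} (hD : D.PosSemidef) :
    ∃ A : Matrix ι ι ℝ, D = Aᵀ * A := by
  obtain ⟨U, l, hl, -, -, hDU⟩ := hD.exists_orthogonal_diagonalization
  refine ⟨Matrix.diagonal (fun a => √(l a)) * Uᵀ, ?_⟩
  rw [Matrix.transpose_mul, Matrix.transpose_transpose, Matrix.diagonal_transpose,
    Matrix.mul_assoc, ← Matrix.mul_assoc (Matrix.diagonal _), Matrix.diagonal_mul_diagonal, hDU,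
    Matrix.mul_assoc]
  simp only [Real.mul_self_sqrt (hl _)]

/-- Whitening: a positive semidefinite quadratic form becomes the standard one in the
coordinates `S`, and `W` transports the covectors it dominates. -/
theorem Matrix.PosSemidef.exists_whitening {D : Matrix ι ι ℝ} (hD : D.PosSemidef) :
    ∃ W S : Matrix ι ι ℝ, (∀ v, v ⬝ᵥ (D *ᵥ v) = (S *ᵥ v) ⬝ᵥ (S *ᵥ v)) ∧
      (∀ g, (Wᵀ *ᵥ g) ⬝ᵥ (D *ᵥ (Wᵀ *ᵥ g)) ≤ g ⬝ᵥ g) ∧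
      ∀ (x : ι → ℝ) (ℓ : ℝ), 0 ≤ ℓ → (∀ v, (x ⬝ᵥ v) ^ 2 ≤ ℓ * (v ⬝ᵥ (D *ᵥ v))) →
        (∀ v, (W *ᵥ x) ⬝ᵥ (S *ᵥ v) = x ⬝ᵥ v) ∧ (W *ᵥ x) ⬝ᵥ (W *ᵥ x) ≤ ℓ := by
  obtain ⟨U, l, hl, hU, hU', hDU⟩ := hD.exists_orthogonal_diagonalization
  have hquad : ∀ v, v ⬝ᵥ (D *ᵥ v) = ∑ a, l a * (Uᵀ *ᵥ v) a ^ 2 := fun v => by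
    rw [hDU, Matrix.dotProduct_orthogonal_diagonal_mulVec]
  -- With 0⁻¹ = 0 this is the indicator of the nonzero eigenvalues, so S Wᵀ is a projection even
  -- when D is singular.
  set e : ι → ℝ := fun a => (√(l a))⁻¹ * √(l a) with he
  have he1 : ∀ a, e a = 0 ∨ e a = 1 := fun a => by
    rcases eq_or_ne (√(l a)) 0 with h | h
    · left; simp [he, h]
    · right; simp [he, h]
  set W := Matrix.diagonal (fun a => (√(l a))⁻¹) * Uᵀ with hW
  set S := Matrix.diagonal (fun a => √(l a)) * Uᵀ with hS
  have hSquad : ∀ v, v ⬝ᵥ (D *ᵥ v) = (S *ᵥ v) ⬝ᵥ (S *ᵥ v) := fun v => by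
    rw [hquad, hS, ← Matrix.mulVec_mulVec]
    simp only [dotProduct, Matrix.mulVec_diagonal]
    refine Finset.sum_congr rfl fun a _ => ?_
    nth_rewrite 1 [← Real.mul_self_sqrt (hl a)]
    ring
  have hSW : S * Wᵀ = Matrix.diagonal e := by
    rw [hS, hW, Matrix.transpose_mul, Matrix.transpose_transpose, Matrix.diagonal_transpose,
      Matrix.mul_assoc, ← Matrix.mul_assoc Uᵀ, hU, Matrix.one_mul, Matrix.diagonal_mul_diagonal]
    simp only [he, mul_comm]
  have hWle : ∀ g, (Wᵀ *ᵥ g) ⬝ᵥ (D *ᵥ (Wᵀ *ᵥ g)) ≤ g ⬝ᵥ g := fun g => by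
    rw [hSquad, Matrix.mulVec_mulVec, hSW]
    simp only [dotProduct, Matrix.mulVec_diagonal]
    refine Finset.sum_le_sum fun a _ => ?_
    rcases he1 a with h | h <;> rw [h]
    · simpa using mul_self_nonneg (g a)
    · simp
  have hSP : S * (Wᵀ * S) = S := by
    rw [← Matrix.mul_assoc, hSW, hS, ← Matrix.mul_assoc, Matrix.diagonal_mul_diagonal]
    congr 2
    funext a
    simp only [he]
    rcases eq_or_ne (√(l a)) 0 with h | h
    · simp [h]
    · field_simp
  refine ⟨W, S, hSquad, hWle, fun x ℓ hℓ hx => ⟨fun v => ?_, ?_⟩⟩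
  -- This vector lies in the kernel of D, where a dominated covector must vanish.
  · have h := hx (v - (Wᵀ * S) *ᵥ v)
    rw [hSquad, Matrix.mulVec_sub, Matrix.mulVec_mulVec, hSP, sub_self, dotProduct_zero,
      mul_zero] at h
    have h0 := pow_eq_zero_iff (two_ne_zero) |>.1 (le_antisymm h (sq_nonneg _))
    rw [dotProduct_sub, sub_eq_zero, ← Matrix.mulVec_mulVec, Matrix.dotProduct_mulVec,
      ← Matrix.mulVec_transpose, Matrix.transpose_transpose] at h0
    exact h0.symm
  -- Testing here gives |Wx|⁴ ≤ ℓ|Wx|²; the case Wx = 0 is separate because of the division.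
  · have h := hx (Wᵀ *ᵥ (W *ᵥ x))
    rw [Matrix.dotProduct_mulVec, ← Matrix.mulVec_transpose, Matrix.transpose_transpose] at h
    have h2 := mul_le_mul_of_nonneg_left (hWle (W *ᵥ x)) hℓ
    have h3 : 0 ≤ (W *ᵥ x) ⬝ᵥ (W *ᵥ x) := Finset.sum_nonneg fun a _ => mul_self_nonneg _
    rcases h3.eq_or_lt with h4 | h4
    · rw [← h4]; exact hℓ
    · exact le_of_mul_le_mul_right (by nlinarith) h4

theorem Matrix.dotProduct_vecMulVec_self_mulVec (z g : ι → ℝ) :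
    g ⬝ᵥ (Matrix.vecMulVec z z *ᵥ g) = (z ⬝ᵥ g) ^ 2 := by
  rw [Matrix.vecMulVec_mulVec, dotProduct_smul, dotProduct_comm g z]
  simp [pow_two]

theorem sum_drawWeight_filter_le {κ : Type*} [Fintype κ] {t : ℕ} {p : κ → ℝ} (hp : ∀ i, 0 ≤ p i)
    (E : (Fin t → κ) → Prop) [DecidablePred E] {f : (Fin t → κ) → ℝ} (hf : ∀ σ, 0 ≤ f σ) {a : ℝ}
    (ha : 0 < a) (hE : ∀ σ, E σ → a ≤ f σ) :
    ∑ σ with E σ, drawWeight p σ ≤ (∑ σ, drawWeight p σ * f σ) / a := by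
  rw [le_div_iff₀ ha, Finset.sum_mul]
  calc ∑ σ with E σ, drawWeight p σ * a ≤ ∑ σ with E σ, drawWeight p σ * f σ :=
        Finset.sum_le_sum fun σ hσ =>
          mul_le_mul_of_nonneg_left (hE σ (Finset.mem_filter.1 hσ).2) (drawWeight_nonneg hp σ)
    _ ≤ _ := Finset.sum_le_sum_of_subset_of_nonneg (Finset.filter_subset _ _)
        fun σ _ _ => mul_nonneg (drawWeight_nonneg hp σ) (hf σ)

open Classical in
/-- Concentration of importance sampled sums of squares of linear forms. -/
theorem sum_drawWeight_exists_lt_le {κ : Type*} [Fintype κ] {t : ℕ} (ht : 0 < t) {p : κ → ℝ}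
    (hp0 : ∀ i, 0 ≤ p i) (hp : ∑ i, p i = 1) {D : Matrix ι ι ℝ} (hD : D.PosSemidef)
    (a : κ → ι → ℝ) {ρ : ℝ} (hρ : 0 ≤ ρ)
    (ha : ∀ i v, (a i ⬝ᵥ v) ^ 2 ≤ ρ * (t * p i) * (v ⬝ᵥ (D *ᵥ v)))
    (hsum : ∀ v, ∑ i, (a i ⬝ᵥ v) ^ 2 ≤ v ⬝ᵥ (D *ᵥ v))
    {m : ℕ} (hm : m ≠ 0) {r η : ℝ} (hr : 2 * m * ρ ≤ r) (hη : 0 < η) :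
    ∑ σ : Fin t → κ with ∃ v, η * (v ⬝ᵥ (D *ᵥ v)) <
        |∑ j, (t * p (σ j))⁻¹ * (a (σ j) ⬝ᵥ v) ^ 2 - ∑ i, (a i ⬝ᵥ v) ^ 2|, drawWeight p σ
      ≤ ((r ^ 2 + 4 * r) / η ^ 2) ^ m * Fintype.card ι := by
  obtain ⟨W, S, hS, hW, hWS⟩ := hD.exists_whitening
  have htR : (0 : ℝ) < t := Nat.cast_pos.2 ht
  have htp : ∀ i, 0 ≤ (t : ℝ) * p i := fun i => mul_nonneg htR.le (hp0 i)
  have hz := fun i => hWS (a i) (ρ * (t * p i)) (mul_nonneg hρ (htp i)) (ha i)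
  set z : κ → ι → ℝ := fun i => W *ᵥ a i with hzdef
  have hz1 : ∀ i v, z i ⬝ᵥ (S *ᵥ v) = a i ⬝ᵥ v := fun i => (hz i).1
  have hz2 : ∀ i, z i ⬝ᵥ z i ≤ ρ * (t * p i) := fun i => (hz i).2
  -- Indices of probability zero still occur in the full sum. Domination makes their terms vanish,
  -- so 0⁻¹ = 0 in Y is harmless.
  have hz0 : ∀ i, (t : ℝ) * p i = 0 → z i = 0 := fun i hi => by
    have h := hz2 i
    rw [hi, mul_zero] at h
    exact dotProduct_self_eq_zero.1
      (le_antisymm h (Finset.sum_nonneg fun a _ => mul_self_nonneg _))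
  set Y : κ → Matrix ι ι ℝ := fun i => (t * p i)⁻¹ • Matrix.vecMulVec (z i) (z i) with hYdef
  have hY : ∀ i, (Y i)ᵀ = Y i := fun i => by
    simp only [hYdef, Matrix.transpose_smul, Matrix.transpose_vecMulVec]
  have hYq : ∀ i g, g ⬝ᵥ (Y i *ᵥ g) = (t * p i)⁻¹ * (z i ⬝ᵥ g) ^ 2 := fun i g => by
    simp only [hYdef]
    rw [Matrix.smul_mulVec, dotProduct_smul, Matrix.dotProduct_vecMulVec_self_mulVec, smul_eq_mul]
  have hR : ∀ i, (ρ • Y i - Y i * Y i).PosSemidef := fun i => by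
    have e : ρ • Y i - Y i * Y i
        = ((t * p i)⁻¹ * (ρ - (t * p i)⁻¹ * (z i ⬝ᵥ z i))) • Matrix.vecMulVec (z i) (z i) := by
      simp only [hYdef]
      rw [Matrix.smul_mul, Matrix.mul_smul, Matrix.vecMulVec_mul_vecMulVec,
        Matrix.vecMulVec_smul, smul_smul, smul_smul, smul_smul, ← sub_smul]
      congr 1
      ring
    rw [e]
    refine Matrix.PosSemidef.of_dotProduct_mulVec_real
      (by rw [Matrix.transpose_smul, Matrix.transpose_vecMulVec]) fun g => ?_
    rw [Matrix.smul_mulVec, dotProduct_smul, Matrix.dotProduct_vecMulVec_self_mulVec, smul_eq_mul]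
    refine mul_nonneg (mul_nonneg (inv_nonneg.2 (htp i)) (sub_nonneg.2 ?_)) (sq_nonneg _)
    rcases (htp i).eq_or_lt with h | h
    · rw [← h]; simpa using hρ
    · rw [inv_mul_le_iff₀ h, mul_comm]; exact hz2 i
  have hNq : ∀ g, g ⬝ᵥ ((∑ i, p i • Y i) *ᵥ g) = (t : ℝ)⁻¹ * ∑ i, (z i ⬝ᵥ g) ^ 2 := fun g => by
    rw [Matrix.sum_mulVec, dotProduct_sum, Finset.mul_sum]
    refine Finset.sum_congr rfl fun i _ => ?_
    rw [Matrix.smul_mulVec, dotProduct_smul, hYq, smul_eq_mul]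
    rcases eq_or_ne (p i) 0 with h | h
    · rw [hz0 i (by rw [h, mul_zero])]; simp
    · field_simp
  have hN : (1 - (t : ℝ) • ∑ i, p i • Y i).PosSemidef := by
    refine Matrix.PosSemidef.of_dotProduct_mulVec_real ?_ fun g => ?_
    · simp only [Matrix.transpose_sub, Matrix.transpose_one, Matrix.transpose_smul,
        Matrix.transpose_sum, hY]
    · rw [Matrix.sub_mulVec, Matrix.one_mulVec, dotProduct_sub, Matrix.smul_mulVec,
        dotProduct_smul, hNq, smul_eq_mul, mul_inv_cancel_left₀ htR.ne', sub_nonneg]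
      refine le_trans (le_of_eq_of_le ?_ (hsum (Wᵀ *ᵥ g))) (hW g)
      refine Finset.sum_congr rfl fun i _ => ?_
      rw [Matrix.dotProduct_mulVec (a i), ← Matrix.mulVec_transpose, Matrix.transpose_transpose]
  have hZt : ∀ σ : Fin t → κ, (centredSum p Y σ)ᵀ = centredSum p Y σ := centredSum_transpose hY
  have hZq : ∀ (σ : Fin t → κ) v, (S *ᵥ v) ⬝ᵥ (centredSum p Y σ *ᵥ (S *ᵥ v))
      = ∑ j, (t * p (σ j))⁻¹ * (a (σ j) ⬝ᵥ v) ^ 2 - ∑ i, (a i ⬝ᵥ v) ^ 2 := fun σ v => by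
    rw [centredSum, Matrix.sum_mulVec, dotProduct_sum]
    simp only [Matrix.sub_mulVec, dotProduct_sub, hYq, hNq, hz1]
    rw [Finset.sum_sub_distrib, Finset.sum_const, Finset.card_univ, Fintype.card_fin,
      nsmul_eq_mul, mul_inv_cancel_left₀ htR.ne']
  refine (sum_drawWeight_filter_le hp0 _ (f := fun σ => (centredSum p Y σ ^ (2 * m)).trace)
    (fun σ => ?_) (pow_pos hη (2 * m)) fun σ hσ => ?_).trans ?_
  · simpa using Matrix.trace_mul_pow_even_nonneg Matrix.PosSemidef.one (hZt σ) m
  · by_contra! hlt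
    obtain ⟨v, hv⟩ := hσ
    have := Matrix.abs_dotProduct_mulVec_le_of_trace_pow_le (hZt σ) hm hη.le hlt.le (S *ᵥ v)
    rw [hZq, ← hS] at this
    exact absurd hv this.not_gt
  · rw [div_pow, ← pow_mul, div_mul_eq_mul_div]
    exact div_le_div_of_nonneg_right
      (sum_drawWeight_trace_pow_le hp0 hp hY hρ hR hN hr le_rfl) (pow_nonneg hη.le _)

end Concentration

/-! ### Leverage scores as bounds on rows -/

section Leverage

variable {n d : ℕ}

theorem hermitianPinv_conjTranspose {G : Matrix (Fin d) (Fin d) ℂ} (hG : G.IsHermitian) :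
    (hermitianPinv hG)ᴴ = hermitianPinv hG := by
  rw [hermitianPinv, ← hG.cfc_eq]
  exact (cfc_predicate (fun μ : ℝ => μ⁻¹) G : IsSelfAdjoint _)

theorem mul_hermitianPinv_mul_gram (B : Matrix (Fin n) (Fin d) ℂ) :
    B * hermitianPinv (Matrix.isHermitian_conjTranspose_mul_self B) * (Bᴴ * B) = B := by
  set Q := hermitianPinv (Matrix.isHermitian_conjTranspose_mul_self B) with hQ
  have hpen : Bᴴ * B * Q * (Bᴴ * B) = Bᴴ * B :=
    (hermitianPinv_penrose (Matrix.isHermitian_conjTranspose_mul_self B)).1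
  have h0 : Bᴴ * B * (Q * (Bᴴ * B) - 1) = 0 := by
    rw [Matrix.mul_sub, ← Matrix.mul_assoc, hpen, Matrix.mul_one, sub_self]
  have h1 : (B * (Q * (Bᴴ * B) - 1))ᴴ * (B * (Q * (Bᴴ * B) - 1)) = 0 := by
    rw [Matrix.conjTranspose_mul, Matrix.mul_assoc, ← Matrix.mul_assoc Bᴴ, h0, Matrix.mul_zero]
  have h2 := Matrix.conjTranspose_mul_self_eq_zero.1 h1
  rw [Matrix.mul_sub, Matrix.mul_one, sub_eq_zero, ← Matrix.mul_assoc] at h2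
  exact h2

/-- The leverage score bounds the relative contribution of a row to the norm of `B v`. -/
theorem norm_mulVec_sq_le_leverageScore_mul (B : Matrix (Fin n) (Fin d) ℂ) (i : Fin n)
    (v : Fin d → ℂ) :
    ‖(B *ᵥ v) i‖ ^ 2 ≤ leverageScore B i * ∑ k, ‖(B *ᵥ v) k‖ ^ 2 := by
  set Q := hermitianPinv (Matrix.isHermitian_conjTranspose_mul_self B) with hQ
  set H := B * Q * Bᴴ with hH
  have hHB : H * B = B := by
    rw [hH, Matrix.mul_assoc]; exact mul_hermitianPinv_mul_gram B
  have hHh : Hᴴ = H := by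
    rw [hH, Matrix.conjTranspose_mul, Matrix.conjTranspose_mul, Matrix.conjTranspose_conjTranspose,
      hermitianPinv_conjTranspose, Matrix.mul_assoc]
  have hHH : H * Hᴴ = H := by
    rw [hHh]
    nth_rewrite 2 [hH]
    rw [← Matrix.mul_assoc, ← Matrix.mul_assoc, hHB]
  -- H is the orthogonal projection onto the column space of B, so its diagonal entries are squared
  -- row norms. As H fixes B v, Cauchy–Schwarz on its i-th row concludes.
  have hlev : leverageScore B i = ∑ k, ‖H i k‖ ^ 2 := by
    have : leverageScore B i = (H i i).re := rfl
    rw [this]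
    conv_lhs => rw [← hHH]
    rw [Matrix.mul_apply, Complex.re_sum]
    refine Finset.sum_congr rfl fun k _ => ?_
    rw [Matrix.conjTranspose_apply, Complex.star_def, Complex.mul_conj, Complex.ofReal_re,
      Complex.normSq_eq_norm_sq]
  have hv : (B *ᵥ v) i = ∑ k, H i k * (B *ᵥ v) k := by
    have : H *ᵥ (B *ᵥ v) = B *ᵥ v := by rw [Matrix.mulVec_mulVec, hHB]
    nth_rewrite 1 [← this]
    rfl
  rw [hlev]
  calc ‖(B *ᵥ v) i‖ ^ 2 ≤ (∑ k, ‖H i k‖ * ‖(B *ᵥ v) k‖) ^ 2 := by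
        rw [hv]
        refine pow_le_pow_left₀ (norm_nonneg _) ((norm_sum_le _ _).trans ?_) 2
        exact Finset.sum_le_sum fun k _ => (norm_mul _ _).le
    _ ≤ _ := Finset.sum_mul_sq_le_sq_mul_sq _ _ _

theorem leverageScore_nonneg (B : Matrix (Fin n) (Fin d) ℂ) (i : Fin n) :
    0 ≤ leverageScore B i := by
  set Q := hermitianPinv (Matrix.isHermitian_conjTranspose_mul_self B) with hQ
  have hpen : Q * (Bᴴ * B) * Q = Q :=
    (hermitianPinv_penrose (Matrix.isHermitian_conjTranspose_mul_self B)).2.1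
  have h : (B * Q * Bᴴ).PosSemidef := by
    have e : B * Q * Bᴴ = (B * Q * Bᴴ)ᴴ * (B * Q * Bᴴ) := by
      have hc : (B * Q * Bᴴ)ᴴ = B * Q * Bᴴ := by
        rw [Matrix.conjTranspose_mul, Matrix.conjTranspose_mul,
          Matrix.conjTranspose_conjTranspose, hermitianPinv_conjTranspose, Matrix.mul_assoc]
      rw [hc]
      calc B * Q * Bᴴ = B * (Q * (Bᴴ * B) * Q) * Bᴴ := by rw [hpen]
        _ = _ := by simp only [Matrix.mul_assoc]
    rw [e]
    exact Matrix.posSemidef_conjTranspose_mul_self _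
  exact (Complex.nonneg_iff.1 (h.diag_nonneg (i := i))).1

end Leverage

/-! ### Quadratic forms at real vectors -/

section QuadraticForms

variable {m n d : ℕ}

theorem realQuadForm_transpose_mul (A M : Matrix (Fin n) (Fin d) ℂ) (x : Fin d → ℝ) :
    realQuadForm (Aᵀ * M) x
      = ∑ i, (A *ᵥ fun k => (x k : ℂ)) i * (M *ᵥ fun k => (x k : ℂ)) i := by
  simp only [realQuadForm, Matrix.mul_apply, Matrix.transpose_apply, Matrix.mulVec, dotProduct]
  simp only [Finset.mul_sum, Finset.sum_mul]
  calc ∑ a, ∑ b, ∑ i, (x a : ℂ) * (A i a * M i b) * (x b : ℂ)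
      = ∑ a, ∑ i, ∑ b, (x a : ℂ) * (A i a * M i b) * (x b : ℂ) :=
        Finset.sum_congr rfl fun a _ => Finset.sum_comm
    _ = ∑ i, ∑ a, ∑ b, (x a : ℂ) * (A i a * M i b) * (x b : ℂ) := Finset.sum_comm
    _ = _ := Finset.sum_congr rfl fun i _ => by
        rw [Finset.sum_comm]
        exact Finset.sum_congr rfl fun a _ => Finset.sum_congr rfl fun b _ => by ring

theorem realQuadForm_add (A M : Matrix (Fin d) (Fin d) ℂ) (x : Fin d → ℝ) :
    realQuadForm (A + M) x = realQuadForm A x + realQuadForm M x := by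
  simp only [realQuadForm, Matrix.add_apply, mul_add, add_mul, Finset.sum_add_distrib]

theorem realQuadForm_smul (a : ℂ) (M : Matrix (Fin d) (Fin d) ℂ) (x : Fin d → ℝ) :
    realQuadForm (a • M) x = a * realQuadForm M x := by
  simp only [realQuadForm, Matrix.smul_apply, smul_eq_mul, Finset.mul_sum]
  exact Finset.sum_congr rfl fun _ _ => Finset.sum_congr rfl fun _ _ => by ring

theorem realQuadForm_sub (A M : Matrix (Fin d) (Fin d) ℂ) (x : Fin d → ℝ) :
    realQuadForm (A - M) x = realQuadForm A x - realQuadForm M x := by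
  simp only [realQuadForm, Matrix.sub_apply, mul_sub, sub_mul, Finset.sum_sub_distrib]

/-- The real part of a row, as a covector. -/
def reRow (B : Matrix (Fin n) (Fin d) ℂ) (i : Fin n) : Fin d → ℝ := fun k => (B i k).re

/-- The imaginary part of a row, as a covector. -/
def imRow (B : Matrix (Fin n) (Fin d) ℂ) (i : Fin n) : Fin d → ℝ := fun k => (B i k).im

theorem mulVec_ofReal_apply (B : Matrix (Fin n) (Fin d) ℂ) (x : Fin d → ℝ) (i : Fin n) :
    (B *ᵥ fun k => (x k : ℂ)) i = ⟨reRow B i ⬝ᵥ x, imRow B i ⬝ᵥ x⟩ := by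
  apply Complex.ext <;>
    simp [Matrix.mulVec, dotProduct, reRow, imRow, Complex.re_sum, Complex.im_sum]

theorem norm_mulVec_ofReal_sq (B : Matrix (Fin n) (Fin d) ℂ) (x : Fin d → ℝ) (i : Fin n) :
    ‖(B *ᵥ fun k => (x k : ℂ)) i‖ ^ 2 = (reRow B i ⬝ᵥ x) ^ 2 + (imRow B i ⬝ᵥ x) ^ 2 := by
  rw [mulVec_ofReal_apply, ← Complex.normSq_eq_norm_sq, Complex.normSq_mk]
  ring

theorem realQuadForm_conjTranspose_mul_self_re (B : Matrix (Fin n) (Fin d) ℂ) (x : Fin d → ℝ) :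
    (realQuadForm (Bᴴ * B) x).re
      = ∑ i, ((reRow B i ⬝ᵥ x) ^ 2 + (imRow B i ⬝ᵥ x) ^ 2) := by
  have h : Bᴴ = (B.map star)ᵀ := rfl
  rw [h, realQuadForm_transpose_mul, Complex.re_sum]
  refine Finset.sum_congr rfl fun i _ => ?_
  rw [← norm_mulVec_ofReal_sq, ← Complex.normSq_eq_norm_sq, ← Complex.ofReal_re (Complex.normSq _),
    Complex.normSq_eq_conj_mul_self]
  congr 2
  simp [Matrix.mulVec, dotProduct, map_sum]

/-- The real part of `B* B`, written through the rows of `B`. -/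
def realGram (B : Matrix (Fin n) (Fin d) ℂ) : Matrix (Fin d) (Fin d) ℝ :=
  ∑ i, (Matrix.vecMulVec (reRow B i) (reRow B i) + Matrix.vecMulVec (imRow B i) (imRow B i))

theorem dotProduct_realGram_mulVec (B : Matrix (Fin n) (Fin d) ℂ) (x : Fin d → ℝ) :
    x ⬝ᵥ (realGram B *ᵥ x) = ∑ i, ((reRow B i ⬝ᵥ x) ^ 2 + (imRow B i ⬝ᵥ x) ^ 2) := by
  rw [realGram, Matrix.sum_mulVec, dotProduct_sum]
  simp only [Matrix.add_mulVec, dotProduct_add, Matrix.dotProduct_vecMulVec_self_mulVec]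

theorem realGram_posSemidef (B : Matrix (Fin n) (Fin d) ℂ) : (realGram B).PosSemidef := by
  refine Matrix.PosSemidef.of_dotProduct_mulVec_real ?_ fun g => ?_
  · simp only [realGram, Matrix.transpose_sum, Matrix.transpose_add, Matrix.transpose_vecMulVec]
  · rw [dotProduct_realGram_mulVec]; positivity

theorem HasRealOrImaginaryRows.transpose_mul_self {B : Matrix (Fin n) (Fin d) ℂ}
    (hB : HasRealOrImaginaryRows B) : HasRealEntries (Bᵀ * B) := fun a b => by
  rw [Matrix.mul_apply, Complex.im_sum]
  refine Finset.sum_eq_zero fun i _ => ?_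
  rcases hB i with h | h <;> simp [Complex.mul_im, h]

theorem HasRealOrImaginaryRows.conjTranspose_mul_self {B : Matrix (Fin n) (Fin d) ℂ}
    (hB : HasRealOrImaginaryRows B) : HasRealEntries (Bᴴ * B) := fun a b => by
  rw [Matrix.mul_apply, Complex.im_sum]
  refine Finset.sum_eq_zero fun i _ => ?_
  rcases hB i with h | h <;> simp [Complex.mul_im, h]

theorem HasRealOrImaginaryRows.sampledMatrix {B : Matrix (Fin n) (Fin d) ℂ}
    (hB : HasRealOrImaginaryRows B) {t : ℕ} (p : Fin n → ℝ) (σ : Fin t → Fin n) :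
    HasRealOrImaginaryRows (sampledMatrix B p σ) := fun j => by
  rcases hB (σ j) with h | h
  · left; intro k; rw [_root_.sampledMatrix, Matrix.of_apply, Complex.im_ofReal_mul, h k, mul_zero]
  · right; intro k; rw [_root_.sampledMatrix, Matrix.of_apply, Complex.re_ofReal_mul, h k, mul_zero]

theorem HasRealEntries.transpose_conjTranspose_mul_self {B : Matrix (Fin n) (Fin d) ℂ}
    (hB : HasRealEntries (Bᴴ * B)) : (Bᴴ * B)ᵀ = Bᴴ * B := by
  ext a b
  have h := Matrix.isHermitian_conjTranspose_mul_self B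
  rw [Matrix.transpose_apply, ← h.apply b a, Complex.star_def]
  exact (Complex.conj_eq_iff_im.2 (hB a b))

/-- Real test vectors suffice because a real positive semidefinite matrix is AᵀA with A real, which
remains a Gram matrix over ℂ. -/
theorem HasRealEntries.posSemidef {Q : Matrix (Fin d) (Fin d) ℂ} (hQ : HasRealEntries Q)
    (hQt : Qᵀ = Q) (h : ∀ x, 0 ≤ (realQuadForm Q x).re) : Q.PosSemidef := by
  have e : Q = (Q.map Complex.re).map Complex.ofReal := by
    ext a b
    exact Complex.ext rfl (hQ a b)
  have hre : (Q.map Complex.re).PosSemidef := by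
    refine Matrix.PosSemidef.of_dotProduct_mulVec_real ?_ fun x => ?_
    · rw [← Matrix.transpose_map, hQt]
    · convert h x using 1
      simp only [realQuadForm, dotProduct, Matrix.mulVec, Finset.mul_sum, Complex.re_sum,
        Matrix.map_apply, Complex.re_mul_ofReal, Complex.re_ofReal_mul, mul_assoc]
  obtain ⟨A, hA⟩ := hre.exists_eq_transpose_mul_self
  have hmap : (Aᵀ * A).map Complex.ofReal = (A.map Complex.ofReal)ᴴ * A.map Complex.ofReal := by
    ext a b; simp [Matrix.mul_apply]
  rw [e, hA, hmap]
  exact Matrix.posSemidef_conjTranspose_mul_self _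

end QuadraticForms

/-! ### Sampling, probabilities and constants -/

section Sampling

variable {n d t : ℕ}

theorem measureReal_draws_preimage {Ω : Type*} [MeasurableSpace Ω] (P : MeasureTheory.Measure Ω)
    [MeasureTheory.IsProbabilityMeasure P] {s : Fin t → Ω → Fin n} (hs : ∀ j, Measurable (s j))
    (hind : ProbabilityTheory.iIndepFun s P) {p : Fin n → ℝ}
    (hp : ∀ j i, P.real {ω | s j ω = i} = p i) (E : Finset (Fin t → Fin n)) :
    P.real ((fun ω j => s j ω) ⁻¹' E) = ∑ σ ∈ E, drawWeight p σ := by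
  have hmeas : Measurable fun ω j => s j ω := measurable_pi_lambda _ hs
  rw [← MeasureTheory.sum_measureReal_preimage_singleton E
    (fun σ _ => hmeas (measurableSet_singleton σ))]
  refine Finset.sum_congr rfl fun σ _ => ?_
  have e : (fun ω j => s j ω) ⁻¹' {σ} = ⋂ j ∈ Finset.univ, s j ⁻¹' {σ j} := by
    ext ω; simp [funext_iff]
  rw [e, MeasureTheory.measureReal_def,
    hind.measure_inter_preimage_eq_mul Finset.univ (fun j _ => measurableSet_singleton (σ j)),
    ENNReal.toReal_prod]
  exact Finset.prod_congr rfl fun j _ => hp j (σ j)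

theorem one_sub_le_measureReal_draws {Ω : Type*} [MeasurableSpace Ω] (P : MeasureTheory.Measure Ω)
    [MeasureTheory.IsProbabilityMeasure P] {s : Fin t → Ω → Fin n} (hs : ∀ j, Measurable (s j))
    (hind : ProbabilityTheory.iIndepFun s P) {p : Fin n → ℝ}
    (hp : ∀ j i, P.real {ω | s j ω = i} = p i) {G : (Fin t → Fin n) → Prop}
    {E : Finset (Fin t → Fin n)} {δ : ℝ} (hG : ∀ σ, σ ∉ E → G σ)
    (hE : ∑ σ ∈ E, drawWeight p σ ≤ δ) :
    1 - δ ≤ P.real {ω | G fun j => s j ω} := by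
  have hmeas : Measurable fun ω j => s j ω := measurable_pi_lambda _ hs
  rw [← measureReal_draws_preimage P hs hind hp] at hE
  have h1 := MeasureTheory.probReal_compl_eq_one_sub (μ := P) (hmeas E.measurableSet)
  have h2 : P.real ((fun ω j => s j ω) ⁻¹' E)ᶜ ≤ P.real {ω | G fun j => s j ω} :=
    MeasureTheory.measureReal_mono fun ω hω => hG _ fun h => hω h
  linarith

/-- The deviation of a sampled sum of squared linear forms from the full sum. -/
noncomputable def samplingDeviation (p : Fin n → ℝ) (a : Fin n → Fin d → ℝ) (σ : Fin t → Fin n)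
    (v : Fin d → ℝ) : ℝ :=
  ∑ j, (t * p (σ j))⁻¹ * (a (σ j) ⬝ᵥ v) ^ 2 - ∑ i, (a i ⬝ᵥ v) ^ 2

theorem sampledMatrix_mulVec (B : Matrix (Fin n) (Fin d) ℂ) (p : Fin n → ℝ) (σ : Fin t → Fin n)
    (v : Fin d → ℂ) (j : Fin t) :
    (sampledMatrix B p σ *ᵥ v) j = ((1 / √(t * p (σ j)) : ℝ) : ℂ) * (B *ᵥ v) (σ j) := by
  simp only [sampledMatrix, Matrix.mulVec, dotProduct, Matrix.of_apply, Finset.mul_sum, mul_assoc]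

theorem realQuadForm_transpose_mul_self (B : Matrix (Fin n) (Fin d) ℂ) (x : Fin d → ℝ) :
    realQuadForm (Bᵀ * B) x
      = ∑ i, (⟨reRow B i ⬝ᵥ x, imRow B i ⬝ᵥ x⟩ : ℂ) * ⟨reRow B i ⬝ᵥ x, imRow B i ⬝ᵥ x⟩ := by
  rw [realQuadForm_transpose_mul]
  simp only [mulVec_ofReal_apply]

theorem realQuadForm_sampledMatrix (B : Matrix (Fin n) (Fin d) ℂ) {p : Fin n → ℝ}
    (hp : ∀ i, 0 ≤ p i) (σ : Fin t → Fin n) (x : Fin d → ℝ) :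
    realQuadForm ((sampledMatrix B p σ)ᵀ * sampledMatrix B p σ) x
      = ∑ j, (((t * p (σ j))⁻¹ : ℝ) : ℂ) * ((⟨reRow B (σ j) ⬝ᵥ x, imRow B (σ j) ⬝ᵥ x⟩ : ℂ)
        * ⟨reRow B (σ j) ⬝ᵥ x, imRow B (σ j) ⬝ᵥ x⟩) := by
  rw [realQuadForm_transpose_mul]
  refine Finset.sum_congr rfl fun j _ => ?_
  rw [sampledMatrix_mulVec, mulVec_ofReal_apply, mul_mul_mul_comm, ← Complex.ofReal_mul]
  congr 2
  have h := Real.mul_self_sqrt (mul_nonneg t.cast_nonneg (hp (σ j)))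
  rw [one_div, ← mul_inv, h]

/-- The sum of the real and imaginary parts of a row, normalised. -/
noncomputable def plusRow (B : Matrix (Fin n) (Fin d) ℂ) (i : Fin n) : Fin d → ℝ :=
  (√2)⁻¹ • (reRow B i + imRow B i)

/-- The difference of the real and imaginary parts of a row, normalised. -/
noncomputable def minusRow (B : Matrix (Fin n) (Fin d) ℂ) (i : Fin n) : Fin d → ℝ :=
  (√2)⁻¹ • (reRow B i - imRow B i)

theorem plusRow_dotProduct_sq (B : Matrix (Fin n) (Fin d) ℂ) (i : Fin n) (x : Fin d → ℝ) :
    (plusRow B i ⬝ᵥ x) ^ 2 = 1 / 2 * (reRow B i ⬝ᵥ x + imRow B i ⬝ᵥ x) ^ 2 := by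
  rw [plusRow, smul_dotProduct, add_dotProduct, smul_eq_mul, mul_pow, inv_pow,
    Real.sq_sqrt zero_le_two, one_div]

theorem minusRow_dotProduct_sq (B : Matrix (Fin n) (Fin d) ℂ) (i : Fin n) (x : Fin d → ℝ) :
    (minusRow B i ⬝ᵥ x) ^ 2 = 1 / 2 * (reRow B i ⬝ᵥ x - imRow B i ⬝ᵥ x) ^ 2 := by
  rw [minusRow, smul_dotProduct, sub_dotProduct, smul_eq_mul, mul_pow, inv_pow,
    Real.sq_sqrt zero_le_two, one_div]

/-- Polarization makes the cross term 2uv a difference of squares, so the imaginary part obeys the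
same concentration bound as the real part. -/
theorem realQuadForm_sampledMatrix_sub (B : Matrix (Fin n) (Fin d) ℂ) {p : Fin n → ℝ}
    (hp : ∀ i, 0 ≤ p i) (σ : Fin t → Fin n) (x : Fin d → ℝ) :
    realQuadForm ((sampledMatrix B p σ)ᵀ * sampledMatrix B p σ) x - realQuadForm (Bᵀ * B) x
      = ⟨samplingDeviation p (reRow B) σ x - samplingDeviation p (imRow B) σ x,
        samplingDeviation p (plusRow B) σ x - samplingDeviation p (minusRow B) σ x⟩ := by
  rw [realQuadForm_sampledMatrix B hp, realQuadForm_transpose_mul_self]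
  simp only [samplingDeviation, plusRow_dotProduct_sq, minusRow_dotProduct_sq]
  apply Complex.ext
  · rw [Complex.sub_re, Complex.re_sum, Complex.re_sum]
    simp only [Complex.ofReal_re, Complex.ofReal_im, Complex.mul_re, zero_mul, sub_zero]
    rw [sub_sub_sub_comm, ← Finset.sum_sub_distrib, ← Finset.sum_sub_distrib]
    congr 1 <;> exact Finset.sum_congr rfl fun _ _ => by ring
  · rw [Complex.sub_im, Complex.im_sum, Complex.im_sum]
    simp only [Complex.ofReal_re, Complex.ofReal_im, Complex.mul_im, zero_mul, add_zero]
    rw [sub_sub_sub_comm, ← Finset.sum_sub_distrib, ← Finset.sum_sub_distrib]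
    congr 1 <;> exact Finset.sum_congr rfl fun _ _ => by ring

theorem loewnerLE_of_realQuadForm {B : Matrix (Fin n) (Fin d) ℂ} {C : Matrix (Fin t) (Fin d) ℂ}
    (hB : HasRealOrImaginaryRows B) (hC : HasRealOrImaginaryRows C) {ε : ℝ}
    (h : ∀ x : Fin d → ℝ, ‖realQuadForm (Cᵀ * C) x - realQuadForm (Bᵀ * B) x‖
      ≤ ε * (realQuadForm (Bᴴ * B) x).re) :
    LoewnerLE (Bᵀ * B - (ε : ℂ) • (Bᴴ * B)) (Cᵀ * C) ∧
      LoewnerLE (Cᵀ * C) (Bᵀ * B + (ε : ℂ) • (Bᴴ * B)) := by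
  have h1 := hB.transpose_mul_self
  have h2 := hB.conjTranspose_mul_self
  have h3 := hC.transpose_mul_self
  have hre : ∀ x : Fin d → ℝ, |(realQuadForm (Cᵀ * C) x).re - (realQuadForm (Bᵀ * B) x).re|
      ≤ ε * (realQuadForm (Bᴴ * B) x).re := fun x =>
    (Complex.abs_re_le_norm _).trans (h x)
  constructor
  · refine HasRealEntries.posSemidef (fun a b => ?_) ?_ fun x => ?_
    · simp [h1 a b, h2 a b, h3 a b]
    · simp only [Matrix.transpose_sub, Matrix.transpose_smul, h2.transpose_conjTranspose_mul_self,
        Matrix.transpose_mul, Matrix.transpose_transpose]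
    · rw [realQuadForm_sub, realQuadForm_sub, realQuadForm_smul, Complex.sub_re, Complex.sub_re,
        Complex.re_ofReal_mul]
      linarith [(abs_le.1 (hre x)).1]
  · refine HasRealEntries.posSemidef (fun a b => ?_) ?_ fun x => ?_
    · simp [h1 a b, h2 a b, h3 a b]
    · simp only [Matrix.transpose_sub, Matrix.transpose_add, Matrix.transpose_smul,
        h2.transpose_conjTranspose_mul_self, Matrix.transpose_mul, Matrix.transpose_transpose]
    · rw [realQuadForm_sub, realQuadForm_add, realQuadForm_smul, Complex.sub_re, Complex.add_re,
        Complex.re_ofReal_mul]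
      linarith [(abs_le.1 (hre x)).2]

theorem samplingProb_nonneg {w : Fin n → ℝ} (hw : ∀ i, 0 ≤ w i) (i : Fin n) :
    0 ≤ samplingProb w i :=
  div_nonneg (hw i) (Finset.sum_nonneg fun j _ => hw j)

theorem sum_samplingProb {w : Fin n → ℝ} (hw : 0 < ∑ i, w i) : ∑ i, samplingProb w i = 1 := by
  simp only [samplingProb, ← Finset.sum_div, div_self hw.ne']

open Classical in
/-- Concentration of sampling by overestimated leverage scores, along any real linear forms
dominated by the rows of `B`. -/
theorem sum_drawWeight_samplingDeviation_le (B : Matrix (Fin n) (Fin d) ℂ) {w : Fin n → ℝ}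
    (hw : ∀ i, leverageScore B i ≤ w i) (hw0 : 0 < ∑ i, w i) (ht : 0 < t)
    (a : Fin n → Fin d → ℝ)
    (ha : ∀ i v, (a i ⬝ᵥ v) ^ 2 ≤ (reRow B i ⬝ᵥ v) ^ 2 + (imRow B i ⬝ᵥ v) ^ 2)
    {m : ℕ} (hm : m ≠ 0) {r η : ℝ} (hr : 2 * m * ((∑ i, w i) / t) ≤ r) (hη : 0 < η) :
    ∑ σ : Fin t → Fin n with ∃ v, η * (realQuadForm (Bᴴ * B) v).re <
        |samplingDeviation (samplingProb w) a σ v|, drawWeight (samplingProb w) σ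
      ≤ ((r ^ 2 + 4 * r) / η ^ 2) ^ m * d := by
  have hwn : ∀ i, 0 ≤ w i := fun i => (leverageScore_nonneg B i).trans (hw i)
  have htR : (0 : ℝ) < t := Nat.cast_pos.2 ht
  have h := sum_drawWeight_exists_lt_le ht (samplingProb_nonneg hwn) (sum_samplingProb hw0)
    (realGram_posSemidef B) a (ρ := (∑ i, w i) / t) (by positivity) (fun i v => ?_) (fun v => ?_)
    hm hr hη
  · simpa only [realQuadForm_conjTranspose_mul_self_re, dotProduct_realGram_mulVec,
      samplingDeviation, Fintype.card_fin] using h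
  -- Sampling proportionally to w is what makes one ρ serve all rows.
  · have e : (∑ i, w i) / t * (t * samplingProb w i) = w i := by
      rw [samplingProb]; field_simp
    rw [e, dotProduct_realGram_mulVec]
    refine (ha i v).trans ?_
    have h1 := norm_mulVec_sq_le_leverageScore_mul B i (fun k => (v k : ℂ))
    simp only [norm_mulVec_ofReal_sq] at h1
    exact h1.trans (mul_le_mul_of_nonneg_right (hw i) (by positivity))
  · rw [dotProduct_realGram_mulVec]
    exact Finset.sum_le_sum fun i _ => ha i v

/-- The numerical choice of the moment order. -/
theorem exists_moment_order {K W ε δ D t : ℝ} (hK : 0 < K) (hW : W ≤ K * D)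
    (hε : 0 < ε) (hε1 : ε ≤ 1) (hδ : 0 < δ) (hδD : 2 * δ ≤ D)
    (ht : 3000 * K * D * (ε ^ 2)⁻¹ * Real.log (D / δ) ≤ t) :
    0 < t ∧ ∃ m : ℕ, m ≠ 0 ∧ ∃ r : ℝ, 2 * m * (W / t) ≤ r ∧
      ((r ^ 2 + 4 * r) / (ε / 4) ^ 2) ^ m * D ≤ δ / 4 := by
  have hD : 0 < D := by linarith
  set L := Real.log (D / δ) with hL
  have h2 : 2 ≤ D / δ := by rwa [le_div_iff₀ hδ]
  have hL2 : 1 / 2 ≤ L := by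
    have h := Real.log_le_log two_pos h2
    linarith [Real.log_two_gt_d9]
  have hL0 : 0 < L := by linarith
  have hx : 0 < 3000 * K * D * (ε ^ 2)⁻¹ * L := by positivity
  have ht0 : 0 < t := hx.trans_le ht
  -- This r makes the base of the power at most 1/3 < 1/e. The exponent 3L then yields (δ/D)³, and
  -- D(δ/D)³ ≤ δ/4 as D/δ ≥ 2. Since L ≥ 1/2, m ≤ 3L + 1 ≤ 5L, so 2m ≤ 10L and 3000 = 10 · 300.
  refine ⟨ht0, ⌈3 * L⌉₊, (Nat.ceil_pos.2 (by linarith)).ne', ε ^ 2 / 300, ?_, ?_⟩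
  · have hm : (⌈3 * L⌉₊ : ℝ) ≤ 5 * L := by
      linarith [Nat.ceil_lt_add_one (a := 3 * L) (by linarith)]
    rw [mul_div_assoc', div_le_iff₀ ht0]
    have h1 : 2 * (⌈3 * L⌉₊ : ℝ) * W ≤ 2 * (5 * L) * (K * D) :=
      (mul_le_mul_of_nonneg_left hW (by positivity)).trans
        (mul_le_mul_of_nonneg_right (by linarith) (by positivity))
    have h3 := mul_le_mul_of_nonneg_left ht (show 0 ≤ ε ^ 2 / 300 by positivity)
    have e : ε ^ 2 / 300 * (3000 * K * D * (ε ^ 2)⁻¹ * L) = 2 * (5 * L) * (K * D) := by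
      field_simp; ring
    linarith
  · have hb : ((ε ^ 2 / 300) ^ 2 + 4 * (ε ^ 2 / 300)) / (ε / 4) ^ 2 ≤ Real.exp (-1) := by
      have h1 : ((ε ^ 2 / 300) ^ 2 + 4 * (ε ^ 2 / 300)) / (ε / 4) ^ 2
          = 16 * (ε ^ 2 / 90000 + 4 / 300) := by
        field_simp; ring
      have h3 : ε ^ 2 ≤ 1 := pow_le_one₀ hε.le hε1
      have h4 : (1 / 3 : ℝ) ≤ Real.exp (-1) := by
        rw [Real.exp_neg, one_div]
        exact inv_anti₀ (Real.exp_pos 1) (by linarith [Real.exp_one_lt_d9])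
      rw [h1]
      linarith
    have hexp : Real.exp (-L) = δ / D := by
      rw [Real.exp_neg, hL, Real.exp_log (by positivity), inv_div]
    have hq : δ / D ≤ 1 / 2 := by rw [div_le_iff₀ hD]; linarith
    have hq0 : 0 < δ / D := by positivity
    calc _ ≤ Real.exp (-1) ^ ⌈3 * L⌉₊ * D :=
          mul_le_mul_of_nonneg_right (pow_le_pow_left₀ (by positivity) hb _) hD.le
      _ ≤ Real.exp (-L) ^ 3 * D := by
          refine mul_le_mul_of_nonneg_right ?_ hD.le
          rw [← Real.exp_nat_mul, ← Real.exp_nat_mul, Real.exp_le_exp]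
          have := Nat.le_ceil (3 * L)
          push_cast
          linarith
      _ = (δ / D) ^ 2 * δ := by rw [hexp]; field_simp
      _ ≤ (1 / 2) ^ 2 * δ :=
          mul_le_mul_of_nonneg_right (pow_le_pow_left₀ hq0.le hq 2) hδ.le
      _ = δ / 4 := by ring

end Sampling

/-! ### Union bound over the four families -/

theorem mainTheorem2 (K : ℝ) :
    ∃ c : ℝ, 0 < c ∧
      ∀ (n d : ℕ) (B : Matrix (Fin n) (Fin d) ℂ), HasRealEntries (Bᵀ * B) →
      ∀ w : Fin n → ℝ, (∀ i, leverageScore B i ≤ w i) → 0 < ∑ i, w i → ∑ i, w i ≤ K * d →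
      ∀ ε δ : ℝ, 0 < ε → ε ≤ 1 → 0 < δ → δ < 1 → 2 * δ ≤ d →
      ∀ t : ℕ, c * d * (ε ^ 2)⁻¹ * Real.log (d / δ) ≤ t →
      ∀ (Ω : Type*) [MeasurableSpace Ω] (P : MeasureTheory.Measure Ω)
        [MeasureTheory.IsProbabilityMeasure P] (s : Fin t → Ω → Fin n),
      (∀ j, Measurable (s j)) → ProbabilityTheory.iIndepFun s P →
      (∀ j i, P.real {ω | s j ω = i} = samplingProb w i) →
      1 - δ ≤ P.real {ω |
        let C : Matrix (Fin t) (Fin d) ℂ := sampledMatrix B (samplingProb w) (fun j => s j ω)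
        (∀ x : Fin d → ℝ,
          ‖realQuadForm (Cᵀ * C) x - realQuadForm (Bᵀ * B) x‖
            ≤ ε * (realQuadForm (Bᴴ * B) x).re) ∧
        (HasRealOrImaginaryRows B →
          LoewnerLE (Bᵀ * B - (ε : ℂ) • (Bᴴ * B)) (Cᵀ * C) ∧
          LoewnerLE (Cᵀ * C) (Bᵀ * B + (ε : ℂ) • (Bᴴ * B)))} := by
  classical
  have hK : 0 < |K| + 1 := by positivity
  -- Using |K| + 1 in place of K keeps the constant positive for every real K.
  refine ⟨3000 * (|K| + 1), by positivity, ?_⟩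
  intro n d B _ w hw hw0 hwK ε δ hε hε1 hδ _ hδd t ht Ω _ P _ s hs hind hsp
  have hKd : ∑ i, w i ≤ (|K| + 1) * d :=
    hwK.trans (mul_le_mul_of_nonneg_right (by linarith [le_abs_self K]) d.cast_nonneg)
  obtain ⟨ht0, m, hm, r, hr, hbound⟩ := exists_moment_order hK hKd hε hε1 hδ hδd ht
  have hp0 : ∀ i, 0 ≤ samplingProb w i :=
    samplingProb_nonneg fun i => (leverageScore_nonneg B i).trans (hw i)
  let bad : (Fin n → Fin d → ℝ) → Finset (Fin t → Fin n) := fun a =>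
    Finset.univ.filter fun σ => ∃ v, ε / 4 * (realQuadForm (Bᴴ * B) v).re <
      |samplingDeviation (samplingProb w) a σ v|
  have hbad : ∀ a : Fin n → Fin d → ℝ,
      (∀ i v, (a i ⬝ᵥ v) ^ 2 ≤ (reRow B i ⬝ᵥ v) ^ 2 + (imRow B i ⬝ᵥ v) ^ 2) →
      ∑ σ ∈ bad a, drawWeight (samplingProb w) σ ≤ δ / 4 := fun a ha =>
    (sum_drawWeight_samplingDeviation_le B hw hw0 (Nat.cast_pos.1 ht0) a ha hm hr
      (by positivity)).trans hbound
  have hgood : ∀ (a : Fin n → Fin d → ℝ) (σ : Fin t → Fin n), σ ∉ bad a → ∀ v,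
      |samplingDeviation (samplingProb w) a σ v|
        ≤ ε / 4 * (realQuadForm (Bᴴ * B) v).re := fun a σ h v => by
    by_contra! hlt
    exact h (Finset.mem_filter.2 ⟨Finset.mem_univ σ, v, hlt⟩)
  have hunion : ∀ S T : Finset (Fin t → Fin n),
      ∑ σ ∈ S ∪ T, drawWeight (samplingProb w) σ
        ≤ ∑ σ ∈ S, drawWeight (samplingProb w) σ
          + ∑ σ ∈ T, drawWeight (samplingProb w) σ := fun S T => by
    rw [← Finset.sum_union_inter]
    exact le_add_of_nonneg_right (Finset.sum_nonneg fun σ _ => drawWeight_nonneg hp0 σ)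
  refine one_sub_le_measureReal_draws P hs hind hsp
    (G := fun σ =>
      let C : Matrix (Fin t) (Fin d) ℂ := sampledMatrix B (samplingProb w) σ
      (∀ x : Fin d → ℝ, ‖realQuadForm (Cᵀ * C) x - realQuadForm (Bᵀ * B) x‖
          ≤ ε * (realQuadForm (Bᴴ * B) x).re) ∧
        (HasRealOrImaginaryRows B →
          LoewnerLE (Bᵀ * B - (ε : ℂ) • (Bᴴ * B)) (Cᵀ * C) ∧
          LoewnerLE (Cᵀ * C) (Bᵀ * B + (ε : ℂ) • (Bᴴ * B))))
    (E := (bad (reRow B) ∪ bad (imRow B)) ∪ (bad (plusRow B) ∪ bad (minusRow B)))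
    (fun σ hσ => ?_) ?_
  · simp only [Finset.mem_union, not_or] at hσ
    obtain ⟨⟨h1, h2⟩, h3, h4⟩ := hσ
    have hquad : ∀ x : Fin d → ℝ,
        ‖realQuadForm ((sampledMatrix B (samplingProb w) σ)ᵀ
            * sampledMatrix B (samplingProb w) σ) x - realQuadForm (Bᵀ * B) x‖
          ≤ ε * (realQuadForm (Bᴴ * B) x).re := fun x => by
      rw [realQuadForm_sampledMatrix_sub B hp0]
      -- Real and imaginary parts are each a difference of two deviations, so four terms of size ε/4
      -- add up to ε.
      refine (Complex.norm_le_abs_re_add_abs_im _).trans ?_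
      refine (add_le_add (abs_sub _ _) (abs_sub _ _)).trans ?_
      linarith [hgood _ σ h1 x, hgood _ σ h2 x, hgood _ σ h3 x, hgood _ σ h4 x]
    exact ⟨hquad, fun hB => loewnerLE_of_realQuadForm hB (hB.sampledMatrix _ σ) hquad⟩
  · have h1 := hbad (reRow B) fun i v => le_add_of_nonneg_right (sq_nonneg _)
    have h2 := hbad (imRow B) fun i v => le_add_of_nonneg_left (sq_nonneg _)
    have h3 := hbad (plusRow B) fun i v => by
      rw [plusRow_dotProduct_sq]
      linarith [sq_nonneg (reRow B i ⬝ᵥ v - imRow B i ⬝ᵥ v)]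
    have h4 := hbad (minusRow B) fun i v => by
      rw [minusRow_dotProduct_sq]
      linarith [sq_nonneg (reRow B i ⬝ᵥ v + imRow B i ⬝ᵥ v)]
    linarith [hunion (bad (reRow B) ∪ bad (imRow B)) (bad (plusRow B) ∪ bad (minusRow B)),
      hunion (bad (reRow B)) (bad (imRow B)), hunion (bad (plusRow B)) (bad (minusRow B))]
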